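/- Setting. Let $f=(f_n)_{n\in\mathbb N}$ be an arbitrary (possibly non-uniform, non-computable) family of functions $f_n:\{0,1\}^n\times\{0,1\}^n\to\{0,1\}$, and for $x\in\{0,1\}^n$ put $Y_1(x)=\{y\in\{0,1\}^n: f_n(x,y)=1\}$. A non-deterministic protocol $P$ for $f_n$ is a finite two-party protocol in which each party sees its own input and its own part of a guess $w$ (the part given to the other party is only learned through communication), the output (in $\{0,1,\bot\}$) is determined by the conversation, and for $z\in\{0,1\}$: if $f_n(x,y)=z$, some $w$ makes $P$ output $z$; if $f_n(x,y)\neq z$, no $w$ does. Let $N_P^z(f_n)$ be the maximum, over $(x,y)$ with $f_n(x,y)=z$, of the least number of bits exchanged over guesses for which $P$ outputs $z$ ($0$ if there is no such $(x,y)$), let $N_P(f_n)=\log_2(2^{N_P^0(f_n)}+2^{N_P^1(f_n)})$, and let $N(f_n)=\min_P N_P(f_n)$. Programs are binary words, executed by a fixed universal oracle machine (a self-delimiting description of a multi-stack oracle machine followed by arbitrary data) with an oracle that returns $f_k(u,v)$ on queries $u,v\in\{0,1\}^k$, for every $k$. For $A\subseteq\{0,1\}^n$, $y\in\{0,1\}^n$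 and $t:\mathbb N\to\mathbb N$, a program $p$ corresponds to $\mathrm{ic}^{f,t}(y:A)$ if on every binary word $u$ it halts within $t(|u|)$ steps with output $0$, $1$ or $\bot$, if for every $u\in\{0,1\}^n$ we have $u\in A$ whenever $p(u)=1$ and $u\notin A$ whenever $p(u)=0$, and if $p(y)\neq\bot$. The instance complexity $\mathrm{ic}^{f,t}(y:A)$ is the minimum of $|p|$ over these programs ($\infty$ if there is none). A rectangle is a set $A\times B$ with $A,B\subseteq\{0,1\}^n$; a $z$-cover of $f_n$ is a finite sequence of rectangles, contained in $f_n^{-1}(z)$, whose union is $f_n^{-1}(z)$; it is minimum if it has the fewest rectangles. Writing sets as characteristic vectors and rectangles and sequences as concatenations, the first minimum $z$-cover is the lexicographically least minimum $z$-cover. Theorem. For every family $f$ there are a computable function $t:\mathbb N\to\mathbb N$ and a constant $c$ such that the following hold. (1) For every $T:\mathbb N\to\mathbb N$ with $T\ge t$ pointwise (in particular for $T=t$) and for every $n$, the number $\max_{|x|=|y|=n}\mathrm{ic}^{f,T}(y:Y_1(x))$ is finite and $$\Bigl|\,N(f_n)-\max_{|x|=|y|=n}\mathrm{ic}^{f,T}(y:Y_1(x))\Bigr|\le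 c .$$ (2) For every $n$, let $\langle R_1,\dots,R_m\rangle$ and $\langle R_{m+1},\dots,R_{m+m'}\rangle$ be the first minimum $0$-cover and the first minimum $1$-cover of $f_n$, and let $R_i=A_i\times B_i$. There are programs $p_1,\dots,p_{m+m'}$ with $\bigl||p_i|-\log_2(m+m')\bigr|\le c$, each of which halts on every word $u$ within $t(|u|)$ steps with output in $\{0,1,\bot\}$, such that on every $y\in\{0,1\}^n$ the program $p_i$ outputs the colour of $R_i$ ($0$ if $i\le m$, $1$ if $i>m$) if $y\in B_i$, and $\bot$ otherwise; if $(x,y)\in R_i$, then $p_i$ corresponds to $\mathrm{ic}^{f,t}(y:Y_1(x))$. Moreover, there is a non-deterministic protocol $P$ for $f_n$ with $N_P(f_n)\le N(f_n)+c$ whose witnesses are exactly these programs: on inputs $(x,y)$ a guess makes $P$ output a value other than $\bot$ if and only if the part given to Alice is some $p_i$ with $(x,y)\in R_i$. -/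

import Mathlib

namespace NDCC

/-- Words of length `n` over the alphabet `{0,1}` (`false` is `0`, `true` is `1`). -/
abbrev Word (n : ℕ) : Type := List.Vector Bool n

/-- An arbitrary (possibly non-uniform) function, given by its restrictions
`{0,1}^n × {0,1}^n → {0,1}` to inputs of length `n`, for every `n`. -/
abbrev Family : Type := (n : ℕ) → Word n → Word n → Bool

/-! ### Non-deterministic communication protocols -/

/-- A protocol tree on inputs of length `n`.  At an inner node one of the parties sends a bit that
it computes from its own input and its own part of the guess (a word it receives from the third
entity); both parties follow the branch of that bit.  A leaf carries the common output
`0`, `1` or `⊥` (`none`). -/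
inductive Protocol (n : ℕ) : Type
  | leaf (out : Option Bool) : Protocol n
  | alice (msg : Word n → List Bool → Bool) (next0 next1 : Protocol n) : Protocol n
  | bob (msg : Word n → List Bool → Bool) (next0 next1 : Protocol n) : Protocol n

namespace Protocol

variable {n : ℕ}

/-- A guess: the part given to Alice and the part given to Bob.  What a party knows of the part
of the other one has to be communicated. -/
abbrev Guess : Type := List Bool × List Bool

/-- The output `P(w,x,y)`. -/
def output : Protocol n → Guess → Word n → Word n → Option Bool
  | leaf out, _, _, _ => out
  | alice msg P₀ P₁, w, x, y => if msg x w.1 then P₁.output w x y else P₀.output w x y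
  | bob msg P₀ P₁, w, x, y => if msg y w.2 then P₁.output w x y else P₀.output w x y

/-- The conversation `c(w)`: the sequence of bits exchanged on inputs `x`, `y` with guess `w`. -/
def conversation : Protocol n → Guess → Word n → Word n → List Bool
  | leaf _, _, _, _ => []
  | alice msg P₀ P₁, w, x, y =>
      msg x w.1 :: (if msg x w.1 then P₁.conversation w x y else P₀.conversation w x y)
  | bob msg P₀ P₁, w, x, y =>
      msg y w.2 :: (if msg y w.2 then P₁.conversation w x y else P₀.conversation w x y)

/-- `P` is a (two-sided) non-deterministic protocol for `g`. -/
def IsFor (P : Protocol n) (g : Word n → Word n → Bool) : Prop :=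
  ∀ (z : Bool) (x y : Word n),
    (g x y = z → ∃ w, P.output w x y = some z) ∧
    (g x y ≠ z → ∀ w, P.output w x y ≠ some z)

/-- Individual complexity of `P` with output value `z`: the shortest conversation over all guesses
that make `P` output `z` (meaningful for `g x y = z` and `P` a protocol for `g`). -/
noncomputable def individualCost (P : Protocol n) (z : Bool) (x y : Word n) : ℕ :=
  sInf {k | ∃ w, P.output w x y = some z ∧ (P.conversation w x y).length = k}

/-- `N_P^z(g)`: the maximum of the individual complexities over the inputs with `g x y = z`
(`0` if there is no such input). -/
noncomputable def sideCost (P : Protocol n) (g : Word n → Word n → Bool) (z : Bool) : ℕ :=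
  (Finset.univ.filter (fun q : Word n × Word n => g q.1 q.2 = z)).sup
    (fun q => P.individualCost z q.1 q.2)

/-- `N_P(g) = log (2 ^ N_P^0(g) + 2 ^ N_P^1(g))`. -/
noncomputable def cost (P : Protocol n) (g : Word n → Word n → Bool) : ℝ :=
  Real.logb 2 ((2 : ℝ) ^ P.sideCost g false + (2 : ℝ) ^ P.sideCost g true)

end Protocol

/-- The two-sided non-deterministic communication complexity `N(g) = min_P N_P(g)`. -/
noncomputable def commComplexity {n : ℕ} (g : Word n → Word n → Bool) : ℝ :=
  sInf {r | ∃ P : Protocol n, P.IsFor g ∧ P.cost g = r}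

/-! ### Rectangles and covers -/

/-- A rectangle `A × B`, given by its two sides. -/
abbrev Rect (n : ℕ) : Type := Finset (Word n) × Finset (Word n)

/-- `(x, y)` belongs to the rectangle. -/
def Rect.Contains {n : ℕ} (R : Rect n) (x y : Word n) : Prop := x ∈ R.1 ∧ y ∈ R.2

/-- A sequence of rectangles is a `z`-cover of `g` if all its rectangles have colour `z` and every
input of value `z` is in one of them. -/
def IsCover {n : ℕ} (g : Word n → Word n → Bool) (z : Bool) (s : List (Rect n)) : Prop :=
  (∀ R ∈ s, ∀ x y, R.Contains x y → g x y = z) ∧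
  (∀ x y, g x y = z → ∃ R ∈ s, R.Contains x y)

/-- A `z`-cover with the smallest number of rectangles. -/
def IsMinCover {n : ℕ} (g : Word n → Word n → Bool) (z : Bool) (s : List (Rect n)) : Prop :=
  IsCover g z s ∧ ∀ s', IsCover g z s' → s.length ≤ s'.length

/-- All words of length `n` in lexicographic order. -/
def allWords : (n : ℕ) → List (Word n)
  | 0 => [List.Vector.nil]
  | n + 1 => (allWords n).map (List.Vector.cons false) ++ (allWords n).map (List.Vector.cons true)

/-- A set of words written as its characteristic bit sequence. -/
def setBits {n : ℕ} (A : Finset (Word n)) : List Bool :=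
  (allWords n).map (fun x => decide (x ∈ A))

/-- A sequence of rectangles written as a bit sequence. -/
def coverBits {n : ℕ} (s : List (Rect n)) : List Bool :=
  s.flatMap (fun R => setBits R.1 ++ setBits R.2)

/-- The first minimum `z`-cover in the lexicographic order (`≤` on `List Bool`). -/
def IsFirstMinCover {n : ℕ} (g : Word n → Word n → Bool) (z : Bool) (s : List (Rect n)) : Prop :=
  IsMinCover g z s ∧ ∀ s', IsMinCover g z s' → coverBits s ≤ coverBits s'

/-! ### Oracle machines with a step count -/

/-- An oracle answers with a bit to a query that consists of two words. -/
abbrev Oracle : Type := List Bool → List Bool → Bool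

/-- The oracle describing `f`: for every `n` it gives the values of `f` on inputs of length `n`
(queries made of two words of different lengths are answered by `0`). -/
def Family.oracle (f : Family) : Oracle := fun u v =>
  if h : v.length = u.length then f u.length ⟨u, rfl⟩ ⟨v, h⟩ else false

/-- Oracle machines working on finitely many stacks of bits, numbered by natural numbers, with
structured control.  Every elementary action touches only the tops of the stacks, so that these
machines are the multi-tape oracle Turing machines up to a constant factor in time. -/
inductive Machine : Type
  | skip : Machine
  | push (r : ℕ) (b : Bool) : Machine
  | pop (r : ℕ) : Machine
  /-- push on stack `a` the answer to the query made of the contents of stacks `q` and `r` -/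
  | query (q r a : ℕ) : Machine
  | seq (M₁ M₂ : Machine) : Machine
  /-- go on according to stack `r`: it is empty, its top is `0`, its top is `1` -/
  | branch (r : ℕ) (Mempty M₀ M₁ : Machine) : Machine
  /-- repeat `M` as long as stack `r` is not empty -/
  | loop (r : ℕ) (M : Machine) : Machine

/-- The contents of the stacks; the head of a list is the top of the stack. -/
abbrev Store : Type := ℕ → List Bool

namespace Machine

/-- `Runs O M σ k σ'`: with oracle `O` and initial contents `σ`, the machine `M` halts after
exactly `k` steps with contents `σ'`. -/
inductive Runs (O : Oracle) : Machine → Store → ℕ → Store → Prop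
  | skip (σ : Store) : Runs O skip σ 1 σ
  | push (r : ℕ) (b : Bool) (σ : Store) :
      Runs O (push r b) σ 1 (Function.update σ r (b :: σ r))
  | pop (r : ℕ) (σ : Store) : Runs O (pop r) σ 1 (Function.update σ r (σ r).tail)
  | query (q r a : ℕ) (σ : Store) :
      Runs O (query q r a) σ 1 (Function.update σ a (O (σ q) (σ r) :: σ a))
  | seq {M₁ M₂ : Machine} {σ σ' σ'' : Store} {k k' : ℕ} :
      Runs O M₁ σ k σ' → Runs O M₂ σ' k' σ'' → Runs O (seq M₁ M₂) σ (k + k') σ''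
  | branch_empty {r : ℕ} {Me M₀ M₁ : Machine} {σ σ' : Store} {k : ℕ} :
      σ r = [] → Runs O Me σ k σ' → Runs O (branch r Me M₀ M₁) σ (k + 1) σ'
  | branch_zero {r : ℕ} {Me M₀ M₁ : Machine} {σ σ' : Store} {k : ℕ} :
      (σ r).head? = some false → Runs O M₀ σ k σ' → Runs O (branch r Me M₀ M₁) σ (k + 1) σ'
  | branch_one {r : ℕ} {Me M₀ M₁ : Machine} {σ σ' : Store} {k : ℕ} :
      (σ r).head? = some true → Runs O M₁ σ k σ' → Runs O (branch r Me M₀ M₁) σ (k + 1) σ'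
  | loop_done {r : ℕ} {M : Machine} {σ : Store} :
      σ r = [] → Runs O (loop r M) σ 1 σ
  | loop_again {r : ℕ} {M : Machine} {σ σ' σ'' : Store} {k k' : ℕ} :
      σ r ≠ [] → Runs O M σ k σ' → Runs O (loop r M) σ' k' σ'' →
      Runs O (loop r M) σ (k + k' + 1) σ''

/-- Machines are deterministic. -/
theorem Runs.det {O : Oracle} {M : Machine} {σ σ₁ σ₂ : Store} {k₁ k₂ : ℕ}
    (h₁ : Runs O M σ k₁ σ₁) (h₂ : Runs O M σ k₂ σ₂) : k₁ = k₂ ∧ σ₁ = σ₂ := by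
  induction h₁ generalizing k₂ σ₂ with
  | skip σ => cases h₂; exact ⟨rfl, rfl⟩
  | push r b σ => cases h₂; exact ⟨rfl, rfl⟩
  | pop r σ => cases h₂; exact ⟨rfl, rfl⟩
  | query q r a σ => cases h₂; exact ⟨rfl, rfl⟩
  | seq _ _ ih₁ ih₂ =>
    cases h₂ with
    | seq a b =>
      obtain ⟨rfl, rfl⟩ := ih₁ a
      obtain ⟨rfl, rfl⟩ := ih₂ b
      exact ⟨rfl, rfl⟩
  | branch_empty e _ ih =>
    cases h₂ with
    | branch_empty e' a => obtain ⟨rfl, rfl⟩ := ih a; exact ⟨rfl, rfl⟩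
    | branch_zero e' a => simp [e] at e'
    | branch_one e' a => simp [e] at e'
  | branch_zero e _ ih =>
    cases h₂ with
    | branch_empty e' a => simp [e'] at e
    | branch_zero e' a => obtain ⟨rfl, rfl⟩ := ih a; exact ⟨rfl, rfl⟩
    | branch_one e' a => simp [e] at e'
  | branch_one e _ ih =>
    cases h₂ with
    | branch_empty e' a => simp [e'] at e
    | branch_zero e' a => simp [e] at e'
    | branch_one e' a => obtain ⟨rfl, rfl⟩ := ih a; exact ⟨rfl, rfl⟩
  | loop_done e =>
    cases h₂ with
    | loop_done e' => exact ⟨rfl, rfl⟩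
    | loop_again e' _ _ => exact absurd e e'
  | loop_again e _ _ ih₁ ih₂ =>
    cases h₂ with
    | loop_done e' => exact absurd e' e
    | loop_again e' a b =>
      obtain ⟨rfl, rfl⟩ := ih₁ a
      obtain ⟨rfl, rfl⟩ := ih₂ b
      exact ⟨rfl, rfl⟩

/-- Self-delimiting code of a natural number. -/
def natCode : ℕ → List Bool
  | 0 => [false]
  | k + 1 => true :: natCode k

/-- Self-delimiting binary description of a machine. -/
def code : Machine → List Bool
  | skip => [false, false, false]
  | push r b => [false, false, true] ++ (natCode r ++ [b])
  | pop r => [false, true, false] ++ natCode r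
  | query q r a => [false, true, true] ++ (natCode q ++ (natCode r ++ natCode a))
  | seq M₁ M₂ => [true, false, false] ++ (code M₁ ++ code M₂)
  | branch r Me M₀ M₁ => [true, false, true] ++ (natCode r ++ (code Me ++ (code M₀ ++ code M₁)))
  | loop r M => [true, true, false] ++ (natCode r ++ code M)

theorem natCode_append_inj {a b : ℕ} {u v : List Bool} (h : natCode a ++ u = natCode b ++ v) :
    a = b ∧ u = v := by
  induction a generalizing b with
  | zero => cases b <;> simp_all [natCode]
  | succ a ih =>
    cases b with
    | zero => simp [natCode] at h
    | succ b =>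
      simp only [natCode, List.cons_append, List.cons.injEq, true_and] at h
      obtain ⟨rfl, h'⟩ := ih h
      exact ⟨rfl, h'⟩

/-- A machine and the data that follow its description can be read off unambiguously. -/
theorem code_append_inj {M M' : Machine} {d d' : List Bool} (h : code M ++ d = code M' ++ d') :
    M = M' ∧ d = d' := by
  induction M generalizing M' d d' with
  | skip => cases M' <;> simp_all [code]
  | push r b =>
    cases M' <;> simp [code] at h
    obtain ⟨rfl, h⟩ := natCode_append_inj h
    simp_all
  | pop r =>
    cases M' <;> simp [code] at h
    obtain ⟨rfl, h⟩ := natCode_append_inj h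
    simp_all
  | query q r a =>
    cases M' <;> simp [code] at h
    obtain ⟨e₁, h₁⟩ := natCode_append_inj h
    obtain ⟨e₂, h₂⟩ := natCode_append_inj h₁
    obtain ⟨e₃, h₃⟩ := natCode_append_inj h₂
    simp [e₁, e₂, e₃, h₃]
  | seq M₁ M₂ ih₁ ih₂ =>
    cases M' <;> simp [code] at h
    obtain ⟨e₁, h₁⟩ := ih₁ h
    obtain ⟨e₂, h₂⟩ := ih₂ h₁
    simp [e₁, e₂, h₂]
  | branch r Me M₀ M₁ ihe ih₀ ih₁ =>
    cases M' <;> simp [code] at h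
    obtain ⟨e₁, h₁⟩ := natCode_append_inj h
    obtain ⟨e₂, h₂⟩ := ihe h₁
    obtain ⟨e₃, h₃⟩ := ih₀ h₂
    obtain ⟨e₄, h₄⟩ := ih₁ h₃
    simp [e₁, e₂, e₃, e₄, h₄]
  | loop r M ih =>
    cases M' <;> simp [code] at h
    obtain ⟨e₁, h₁⟩ := natCode_append_inj h
    obtain ⟨e₂, h₂⟩ := ih h₁
    simp [e₁, e₂, h₂]

end Machine

/-- Initial contents: the input `y` on stack `0`, the data `d` of the program on stack `1`. -/
def initStore (y d : List Bool) : Store := fun r => if r = 0 then y else if r = 1 then d else []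

/-- The output values `0`, `1` and `⊥` as words. -/
def outputWord : Option Bool → List Bool
  | none => []
  | some b => [b]

/-- `Outputs O p y k v`: with oracle `O`, the program `p` (a binary word) on input `y` halts after
exactly `k` steps with output `v`.  A program is the description of a machine followed by
arbitrary data, and is executed by running that machine on the input and the data (the standard
universal machine); the output is read from stack `2`. -/
def Outputs (O : Oracle) (p y : List Bool) (k : ℕ) (v : Option Bool) : Prop :=
  ∃ (M : Machine) (d : List Bool) (σ : Store),
    p = M.code ++ d ∧ M.Runs O (initStore y d) k σ ∧ σ 2 = outputWord v

/-! ### Instance complexity -/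

/-- On every word `u`, the program `p` halts within `t |u|` steps and outputs `0`, `1` or `⊥`. -/
def TotalWithin (O : Oracle) (t : ℕ → ℕ) (p : List Bool) : Prop :=
  ∀ u : List Bool, ∃ k ≤ t u.length, ∃ v, Outputs O p u k v

/-- `p` is consistent with the set `A` of words of length `n`: among these words, the answers `1`
and `0` of `p` are correct. -/
def Consistent (O : Oracle) {n : ℕ} (p : List Bool) (A : Set (Word n)) : Prop :=
  ∀ u : Word n, ((∃ k, Outputs O p u.toList k (some true)) → u ∈ A) ∧
    ((∃ k, Outputs O p u.toList k (some false)) → u ∉ A)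

/-- The program `p` corresponds to `ic^{O,t}(y : A)`. -/
def Corresponds (O : Oracle) (t : ℕ → ℕ) {n : ℕ} (y : Word n) (A : Set (Word n))
    (p : List Bool) : Prop :=
  TotalWithin O t p ∧ Consistent O p A ∧ ¬ ∃ k, Outputs O p y.toList k none

/-- The `t`-bounded instance complexity `ic^{O,t}(y : A)`, the length of a shortest program that
corresponds to it (`⊤` if there is none). -/
noncomputable def instComplexity (O : Oracle) (t : ℕ → ℕ) {n : ℕ} (y : Word n)
    (A : Set (Word n)) : ℕ∞ :=
  ⨅ p ∈ {p : List Bool | Corresponds O t y A p}, (p.length : ℕ∞)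

/-- `Y₁(x) = {y : g x y = 1}`. -/
def Y₁ {n : ℕ} (g : Word n → Word n → Bool) (x : Word n) : Set (Word n) := {y | g x y = true}

/-- `max_{|x| = |y| = n} ic^{f,t}(y : Y₁(x))`. -/
noncomputable def maxInstComplexity (f : Family) (t : ℕ → ℕ) (n : ℕ) : ℕ∞ :=
  ⨆ (x : Word n) (y : Word n), instComplexity f.oracle t y (Y₁ (f n) x)

/-- The value that a program built from the rectangle `R` of colour `z` outputs on `y`:
`z` if `y` is in the side `B` of `R = A × B`, and `⊥` otherwise. -/
def rectAnswer {n : ℕ} (R : Rect n) (z : Bool) (y : Word n) : Option Bool :=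
  if y ∈ R.2 then some z else none

end NDCC

/-! Up to a constant, both quantities are log₂(m + m'), where m and m' are the sizes of a minimum
0-cover and a minimum 1-cover of f_n.

Covers from protocols and from programs. The pairs (input, own guess) of Alice and those of Bob that
lead to a fixed leaf of a protocol form a product set, since neither party sees the other's guess.
Forgetting the guesses gives a rectangle, and a tree has at most 2^d leaves down to depth d
(`Protocol.exists_isCover_of_isFor`). Likewise a program p and a colour z give the rectangle of all
x such that p is total in time and consistent with Y₁(x), times all y on which p answers z. There
are fewer than 2^(K+1) programs of length at most K (`exists_isCover_of_corresponds`). The second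
argument works for every time bound, which is why all T ≥ t are allowed.

Programs and protocols from covers. List the rectangles of both first minimum covers; an index needs
L = ⌈log₂(m + m')⌉ digits. One machine, independent of n and f, asks the oracle for the whole table
of f_n, finds the covers by exhaustive search and tests whether y lies in B_i; its description
followed by the digits of i is p_i. In the protocol, Alice checks that her guess is some p_i with x
in A_i and sends i, and Bob replies whether y is in B_i (`Protocol.exists_protocol_of_rects`).

What remains is to exhibit this machine with a computable time bound. The search is bounded, hence
primitive recursive in n, y, i and the table coded as a number. Loop programs, whose loops have a
number of rounds known at entry, compute all primitive recursive functions on unary numbers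
(`LoopProg.exists_computes`) and halt within a primitive recursive bound in the initial stack
heights (`LoopProg.runs`). -/

namespace NDCC

open Function (update)

/-! ### Protocols and covers by rectangles -/

namespace Protocol

variable {n : ℕ}

/-- The rectangles of the leaves of value `z` up to depth `d`, where the knowledge of Alice and Bob
is restricted to `A` and `B`. -/
noncomputable def leafRects (z : Bool) : Protocol n → ℕ → Set (Word n × List Bool) →
    Set (Word n × List Bool) → List (Rect n)
  | leaf out, _, A, B => by
      classical
      exact if out = some z then [(Finset.univ.filter fun x => ∃ w, (x, w) ∈ A,
        Finset.univ.filter fun y => ∃ w, (y, w) ∈ B)] else []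
  | alice _ _ _, 0, _, _ => []
  | alice msg P₀ P₁, d + 1, A, B =>
      P₀.leafRects z d (A ∩ {q | msg q.1 q.2 = false}) B ++
        P₁.leafRects z d (A ∩ {q | msg q.1 q.2 = true}) B
  | bob _ _ _, 0, _, _ => []
  | bob msg P₀ P₁, d + 1, A, B =>
      P₀.leafRects z d A (B ∩ {q | msg q.1 q.2 = false}) ++
        P₁.leafRects z d A (B ∩ {q | msg q.1 q.2 = true})

theorem length_leafRects_le (z : Bool) (P : Protocol n) (d : ℕ) (A B : Set (Word n × List Bool)) :
    (P.leafRects z d A B).length ≤ 2 ^ d := by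
  induction P generalizing d A B with
  | leaf out =>
    have := Nat.one_le_two_pow (n := d)
    simp only [leafRects]
    split_ifs <;> simp
    exact this
  | alice msg P₀ P₁ h₀ h₁ =>
    cases d with
    | zero => simp [leafRects]
    | succ d =>
      rw [leafRects, List.length_append, pow_succ, mul_two]
      exact Nat.add_le_add (h₀ _ _ _) (h₁ _ _ _)
  | bob msg P₀ P₁ h₀ h₁ =>
    cases d with
    | zero => simp [leafRects]
    | succ d =>
      rw [leafRects, List.length_append, pow_succ, mul_two]
      exact Nat.add_le_add (h₀ _ _ _) (h₁ _ _ _)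

/-- Soundness of the leaf rectangles: the guess parts that put x on Alice's side and y on Bob's side
are chosen independently and together form one guess reaching the leaf. -/
theorem exists_output_of_mem_leafRects {z : Bool} {P : Protocol n} {d : ℕ}
    {A B : Set (Word n × List Bool)} {R : Rect n} (hR : R ∈ P.leafRects z d A B) {x y : Word n}
    (h : R.Contains x y) :
    ∃ w : Guess, (x, w.1) ∈ A ∧ (y, w.2) ∈ B ∧ P.output w x y = some z := by
  induction P generalizing d A B with
  | leaf out =>
    simp only [leafRects] at hR
    split_ifs at hR with ho
    · obtain rfl := List.mem_singleton.1 hR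
      simp only [Rect.Contains, Finset.mem_filter, Finset.mem_univ, true_and] at h
      obtain ⟨⟨w, hw⟩, w', hw'⟩ := h
      exact ⟨(w, w'), hw, hw', ho⟩
    · simp at hR
  | alice msg P₀ P₁ h₀ h₁ =>
    cases d with
    | zero => simp [leafRects] at hR
    | succ d =>
      rw [leafRects, List.mem_append] at hR
      rcases hR with hR | hR
      · obtain ⟨w, hA, hB, ho⟩ := h₀ hR
        exact ⟨w, hA.1, hB, by simpa [output, show msg x w.1 = false from hA.2] using ho⟩
      · obtain ⟨w, hA, hB, ho⟩ := h₁ hR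
        exact ⟨w, hA.1, hB, by simpa [output, show msg x w.1 = true from hA.2] using ho⟩
  | bob msg P₀ P₁ h₀ h₁ =>
    cases d with
    | zero => simp [leafRects] at hR
    | succ d =>
      rw [leafRects, List.mem_append] at hR
      rcases hR with hR | hR
      · obtain ⟨w, hA, hB, ho⟩ := h₀ hR
        exact ⟨w, hA, hB.1, by simpa [output, show msg y w.2 = false from hB.2] using ho⟩
      · obtain ⟨w, hA, hB, ho⟩ := h₁ hR
        exact ⟨w, hA, hB.1, by simpa [output, show msg y w.2 = true from hB.2] using ho⟩

/-- Completeness: a conversation of at most d bits ends at a leaf that the truncation at depth d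
keeps. -/
theorem exists_mem_leafRects {z : Bool} {P : Protocol n} {d : ℕ} {A B : Set (Word n × List Bool)}
    {w : Guess} {x y : Word n} (hA : (x, w.1) ∈ A) (hB : (y, w.2) ∈ B)
    (ho : P.output w x y = some z) (hd : (P.conversation w x y).length ≤ d) :
    ∃ R ∈ P.leafRects z d A B, R.Contains x y := by
  induction P generalizing d A B with
  | leaf out =>
    have ho' : out = some z := ho
    simp only [leafRects, if_pos ho', List.mem_singleton, exists_eq_left, Rect.Contains,
      Finset.mem_filter, Finset.mem_univ, true_and]
    exact ⟨⟨_, hA⟩, _, hB⟩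
  | alice msg P₀ P₁ h₀ h₁ =>
    cases d with
    | zero => simp [conversation] at hd
    | succ d =>
      rw [leafRects]
      rcases hm : msg x w.1
      · obtain ⟨R, hR, hc⟩ := h₀ (d := d) (A := A ∩ {q | msg q.1 q.2 = false}) ⟨hA, hm⟩ hB
          (by simpa [output, hm] using ho) (by simpa [conversation, hm] using hd)
        exact ⟨R, List.mem_append_left _ hR, hc⟩
      · obtain ⟨R, hR, hc⟩ := h₁ (d := d) (A := A ∩ {q | msg q.1 q.2 = true}) ⟨hA, hm⟩ hB
          (by simpa [output, hm] using ho) (by simpa [conversation, hm] using hd)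
        exact ⟨R, List.mem_append_right _ hR, hc⟩
  | bob msg P₀ P₁ h₀ h₁ =>
    cases d with
    | zero => simp [conversation] at hd
    | succ d =>
      rw [leafRects]
      rcases hm : msg y w.2
      · obtain ⟨R, hR, hc⟩ := h₀ (d := d) (B := B ∩ {q | msg q.1 q.2 = false}) hA ⟨hB, hm⟩
          (by simpa [output, hm] using ho) (by simpa [conversation, hm] using hd)
        exact ⟨R, List.mem_append_left _ hR, hc⟩
      · obtain ⟨R, hR, hc⟩ := h₁ (d := d) (B := B ∩ {q | msg q.1 q.2 = true}) hA ⟨hB, hm⟩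
          (by simpa [output, hm] using ho) (by simpa [conversation, hm] using hd)
        exact ⟨R, List.mem_append_right _ hR, hc⟩

/-- The infimum in `individualCost` is over a nonempty set of naturals, hence attained; `sideCost`
is the maximum of these values. -/
theorem exists_guess_of_isFor {P : Protocol n} {g : Word n → Word n → Bool} (hP : P.IsFor g)
    {z : Bool} {x y : Word n} (h : g x y = z) :
    ∃ w, P.output w x y = some z ∧ (P.conversation w x y).length ≤ P.sideCost g z := by
  obtain ⟨w, hw⟩ := (hP z x y).1 h
  have hmem := Nat.sInf_mem
    (s := {k | ∃ w, P.output w x y = some z ∧ (P.conversation w x y).length = k}) ⟨_, w, hw, rfl⟩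
  obtain ⟨w', h₁, h₂⟩ := hmem
  refine ⟨w', h₁, h₂.le.trans ?_⟩
  exact Finset.le_sup (f := fun q : Word n × Word n => P.individualCost z q.1 q.2)
    (b := (x, y)) (by simpa using h)

/-- The conversations of a protocol yield covers. -/
theorem exists_isCover_of_isFor {P : Protocol n} {g : Word n → Word n → Bool} (hP : P.IsFor g)
    (z : Bool) : ∃ s, IsCover g z s ∧ s.length ≤ 2 ^ P.sideCost g z := by
  refine ⟨P.leafRects z (P.sideCost g z) Set.univ Set.univ, ⟨?_, ?_⟩,
    length_leafRects_le _ _ _ _ _⟩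
  · intro R hR x y hc
    obtain ⟨w, -, -, ho⟩ := exists_output_of_mem_leafRects hR hc
    by_contra h
    exact (hP z x y).2 h w ho
  · intro x y h
    obtain ⟨w, ho, hl⟩ := exists_guess_of_isFor hP h
    exact exists_mem_leafRects (Set.mem_univ _) (Set.mem_univ _) ho hl

/-- Alice sends the bits `ms`, and the protocol goes on according to them. -/
def sendAll : List (Word n → List Bool → Bool) → (List Bool → Protocol n) → Protocol n
  | [], k => k []
  | m :: ms, k => alice m (sendAll ms fun l => k (false :: l)) (sendAll ms fun l => k (true :: l))

theorem output_sendAll (ms : List (Word n → List Bool → Bool)) (k : List Bool → Protocol n)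
    (w : Guess) (x y : Word n) :
    (sendAll ms k).output w x y = (k (ms.map fun m => m x w.1)).output w x y := by
  induction ms generalizing k with
  | nil => rfl
  | cons m ms ih =>
    simp only [sendAll, output, ih, List.map_cons]
    cases m x w.1 <;> rfl

theorem length_conversation_sendAll (ms : List (Word n → List Bool → Bool))
    (k : List Bool → Protocol n) (w : Guess) (x y : Word n) :
    ((sendAll ms k).conversation w x y).length =
      ms.length + ((k (ms.map fun m => m x w.1)).conversation w x y).length := by
  induction ms generalizing k with
  | nil => simp [sendAll]
  | cons m ms ih =>
    simp only [sendAll, conversation, List.map_cons, List.length_cons]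
    cases m x w.1 <;> simp [ih] <;> ring

/-- Both side costs are at most L, and 2^L + 2^L = 2^(L+1). -/
theorem cost_le_of_length_le {P : Protocol n} {g : Word n → Word n → Bool} (hP : P.IsFor g)
    {L : ℕ} (h : ∀ w x y, (P.conversation w x y).length ≤ L) : P.cost g ≤ L + 1 := by
  have hs : ∀ z, P.sideCost g z ≤ L := by
    intro z
    refine Finset.sup_le fun q hq => ?_
    obtain ⟨w, hw⟩ := (hP z q.1 q.2).1 (by simpa using hq)
    exact (Nat.sInf_le (show _ ∈ {k | ∃ w, P.output w q.1 q.2 = some z ∧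
      (P.conversation w q.1 q.2).length = k} from ⟨w, hw, rfl⟩)).trans (h w q.1 q.2)
  have h2 : ∀ z, (2 : ℝ) ^ P.sideCost g z ≤ 2 ^ L := fun z =>
    pow_le_pow_right₀ (by norm_num) (hs z)
  calc P.cost g ≤ Real.logb 2 ((2 : ℝ) ^ (L + 1)) := by
        refine Real.logb_le_logb_of_le (by norm_num) (by positivity) ?_
        rw [pow_succ]
        linarith [h2 false, h2 true]
    _ = L + 1 := by
        rw [← Real.rpow_natCast, Real.logb_rpow (by norm_num) (by norm_num)]
        push_cast
        rfl

/-- A protocol whose witnesses are given words, one for each rectangle. -/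
theorem exists_protocol_of_rects {g : Word n → Word n → Bool} (S : List (Rect n))
    (color : Fin S.length → Bool)
    (hS : ∀ i x y, (S.get i).Contains x y → g x y = color i)
    (hS' : ∀ x y, ∃ i, (S.get i).Contains x y)
    (prog : Fin S.length → List Bool) (hprog : Function.Injective prog)
    {L : ℕ} (hL : S.length ≤ 2 ^ L) :
    ∃ P : Protocol n, P.IsFor g ∧ P.cost g ≤ L + 3 ∧
      ∀ (w : Guess) (x y : Word n),
        P.output w x y ≠ none ↔ ∃ i, w.1 = prog i ∧ (S.get i).Contains x y := by
  classical
  -- The default 0 for a word that is no `prog i` is harmless: the bit `valid` is then false and the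
  -- protocol ends in ⊥.
  let idx : List Bool → ℕ := fun w => if h : ∃ i, w = prog i then (h.choose : ℕ) else 0
  have hidx : ∀ i, idx (prog i) = i := by
    intro i
    have h : ∃ j, prog i = prog j := ⟨i, rfl⟩
    simp only [idx, dif_pos h]
    rw [← hprog h.choose_spec]
  let valid : Word n → List Bool → Bool := fun x w => decide (∃ i, w = prog i ∧ x ∈ (S.get i).1)
  let bits : ℕ → List Bool := fun i => (List.range L).map i.testBit
  have hbits : ∀ i j : Fin S.length, bits i = bits j → i = j := by
    intro i j h
    apply Fin.ext
    apply Nat.eq_of_testBit_eq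
    intro r
    by_cases hr : r < L
    · exact List.map_inj_left.1 h r (List.mem_range.2 hr)
    · have h2 : 2 ^ L ≤ 2 ^ r := Nat.pow_le_pow_right (by omega) (by omega)
      rw [Nat.testBit_lt_two_pow (by omega), Nat.testBit_lt_two_pow (by omega)]
  -- One validity bit, L digits of the index and at most one bit from Bob: this is the L + 2 of
  -- `hlen`, to which `cost_le_of_length_le` adds one.
  let msgs : List (Word n → List Bool → Bool) :=
    valid :: (List.range L).map fun r _ w => (idx w).testBit r
  let reply : List Bool → Protocol n := fun l =>
    if h : ∃ i : Fin S.length, l = true :: bits i then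
      bob (fun y _ => decide (y ∈ (S.get h.choose).2)) (leaf none) (leaf (some (color h.choose)))
    else leaf none
  have hmsgs : ∀ x w, (msgs.map fun m => m x w) = valid x w :: bits (idx w) := by
    intro x w
    simp [msgs, bits, Function.comp_def]
  let P := sendAll msgs reply
  have hout : ∀ (w : Guess) (x y : Word n) (z : Bool), P.output w x y = some z ↔
      ∃ i, w.1 = prog i ∧ (S.get i).Contains x y ∧ color i = z := by
    intro w x y z
    simp only [P, output_sendAll, hmsgs]
    by_cases hv : ∃ i, w.1 = prog i ∧ x ∈ (S.get i).1
    · have hv' : valid x w.1 = true := decide_eq_true hv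
      obtain ⟨i, hi, hx⟩ := hv
      have hex : ∃ j : Fin S.length, valid x w.1 :: bits (idx w.1) = true :: bits j :=
        ⟨i, by rw [hv', hi, hidx]⟩
      have hch : hex.choose = i := by
        have h := (List.cons.inj hex.choose_spec).2
        have e : bits (idx w.1) = bits i := by rw [hi, hidx]
        exact hbits _ _ (h.symm.trans e)
      simp only [reply, dif_pos hex, output, hch]
      constructor
      · intro h
        by_cases hy : y ∈ (S.get i).2
        · simp only [hy, decide_true, if_true, Option.some.injEq] at h
          exact ⟨i, hi, ⟨hx, hy⟩, h⟩
        · simp only [hy, decide_false, Bool.false_eq_true, if_false, reduceCtorEq] at h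
      · rintro ⟨j, hj, ⟨-, hy⟩, hz⟩
        obtain rfl := hprog (hi.symm.trans hj)
        simp only [hy, decide_true, if_true, hz]
    · have hv' : valid x w.1 = false := decide_eq_false hv
      have hex : ¬ ∃ j : Fin S.length, valid x w.1 :: bits (idx w.1) = true :: bits j := by
        simp [hv']
      simp only [reply, dif_neg hex, output]
      constructor
      · intro h; simp at h
      · rintro ⟨i, hi, ⟨hx, -⟩, -⟩
        exact absurd ⟨i, hi, hx⟩ hv
  have hlen : ∀ w x y, (P.conversation w x y).length ≤ L + 2 := by
    intro w x y
    have hr : ∀ l, ((reply l).conversation w x y).length ≤ 1 := by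
      intro l
      simp only [reply]
      split_ifs with h
      · simp only [conversation, List.length_cons]
        split_ifs <;> simp
      · simp [conversation]
    have hl : msgs.length = L + 1 := by simp [msgs]
    have := hr (msgs.map fun m => m x w.1)
    simp only [P, length_conversation_sendAll, hl]
    omega
  have hP : P.IsFor g := by
    intro z x y
    refine ⟨fun h => ?_, fun h w hw => ?_⟩
    · obtain ⟨i, hi⟩ := hS' x y
      exact ⟨(prog i, []), (hout _ _ _ _).2 ⟨i, rfl, hi, by rw [← hS i x y hi, h]⟩⟩
    · obtain ⟨i, -, hi, hz⟩ := (hout _ _ _ _).1 hw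
      exact h (by rw [hS i x y hi, hz])
  refine ⟨P, hP, ?_, fun w x y => ?_⟩
  · have := cost_le_of_length_le hP hlen
    push_cast at this
    linarith
  · rw [Option.ne_none_iff_exists']
    constructor
    · rintro ⟨z, hz⟩
      obtain ⟨i, h₁, h₂, -⟩ := (hout _ _ _ _).1 hz
      exact ⟨i, h₁, h₂⟩
    · rintro ⟨i, h₁, h₂⟩
      exact ⟨color i, (hout _ _ _ _).2 ⟨i, h₁, h₂, rfl⟩⟩

end Protocol

/-! ### Loop programs and their time bound -/

/-- Machines all of whose loops are of the form `each r P`: run `P` and pop `r`, until `r` is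
empty.  If `P` leaves `r` alone, the number of rounds is known in advance. -/
inductive LoopProg : Type
  | skip : LoopProg
  | push (r : ℕ) (b : Bool) : LoopProg
  | pop (r : ℕ) : LoopProg
  | query (q r a : ℕ) : LoopProg
  | seq (P Q : LoopProg) : LoopProg
  | branch (r : ℕ) (E Z U : LoopProg) : LoopProg
  | each (r : ℕ) (P : LoopProg) : LoopProg

namespace LoopProg

/-- The machine that executes a loop program. -/
def toMachine : LoopProg → Machine
  | skip => .skip
  | push r b => .push r b
  | pop r => .pop r
  | query q r a => .query q r a
  | seq P Q => .seq P.toMachine Q.toMachine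
  | branch r E Z U => .branch r E.toMachine Z.toMachine U.toMachine
  | each r P => .loop r (.seq P.toMachine (.pop r))

/-- The contents of the stacks after the execution. -/
def eval (O : Oracle) : LoopProg → Store → Store
  | skip, σ => σ
  | push r b, σ => Function.update σ r (b :: σ r)
  | pop r, σ => Function.update σ r (σ r).tail
  | query q r a, σ => Function.update σ a (O (σ q) (σ r) :: σ a)
  | seq P Q, σ => Q.eval O (P.eval O σ)
  | branch r E Z U, σ =>
      match σ r with
      | [] => E.eval O σ
      | false :: _ => Z.eval O σ
      | true :: _ => U.eval O σ
  | each r P, σ =>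
      (fun τ => Function.update (P.eval O τ) r (P.eval O τ r).tail)^[(σ r).length] σ

/-- The stacks that may change. -/
def Writes : LoopProg → ℕ → Prop
  | skip, _ => False
  | push r _, s => s = r
  | pop r, s => s = r
  | query _ _ a, s => s = a
  | seq P Q, s => P.Writes s ∨ Q.Writes s
  | branch _ E Z U, s => E.Writes s ∨ Z.Writes s ∨ U.Writes s
  | each r P, s => s = r ∨ P.Writes s

/-- The counter of a loop is not touched by its body, and it is not the stack `1` of the data. -/
def WF : LoopProg → Prop
  | seq P Q => P.WF ∧ Q.WF
  | branch _ E Z U => E.WF ∧ Z.WF ∧ U.WF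
  | each r P => P.WF ∧ ¬ P.Writes r ∧ r ≠ 1
  | _ => True

/-- A bound on time and on the heights of the stacks, in terms of the heights at the beginning. -/
def bound : LoopProg → ℕ → ℕ
  | seq P Q, s => Q.bound (P.bound s) + P.bound s
  | branch _ E Z U, s => E.bound s + Z.bound s + U.bound s + 1
  | each _ P, s => s * ((P.bound^[s]) s + 2) + 1 + (P.bound^[s]) s
  | _, s => s + 1

/-- Makes the iterates of `bound` increase with the number of iterations, so that an upper estimate
of the number of rounds of a loop may replace the number itself. -/
theorem le_bound (P : LoopProg) (s : ℕ) : s ≤ P.bound s := by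
  induction P generalizing s with
  | seq P Q ihP ihQ => have := ihP s; simp only [bound]; omega
  | branch r E Z U h _ _ => have := h s; simp only [bound]; omega
  | each r P ih =>
    have : s ≤ (P.bound^[s]) s := Function.id_le_iterate_of_id_le (fun x => ih x) s s
    simp only [bound]; omega
  | _ => simp [bound]

/-- The source of the computability of t. A loop iterates the bound of its body a variable number of
times, which stays primitive recursive. -/
theorem primrec_bound (P : LoopProg) : Primrec P.bound := by
  induction P with
  | seq P Q ihP ihQ => exact Primrec.nat_add.comp (ihQ.comp ihP) ihP
  | branch r E Z U h₁ h₂ h₃ =>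
    exact Primrec.nat_add.comp
      (Primrec.nat_add.comp (Primrec.nat_add.comp h₁ h₂) h₃) (Primrec.const 1)
  | each r P ih =>
    have h : Primrec fun s => (P.bound^[s]) s :=
      Primrec.nat_iterate Primrec.id Primrec.id (ih.comp Primrec.snd).to₂
    exact Primrec.nat_add.comp (Primrec.nat_add.comp (Primrec.nat_mul.comp Primrec.id
      (Primrec.nat_add.comp h (Primrec.const 2))) (Primrec.const 1)) h
  | _ => exact Primrec.succ

/-- For the counter of a well-formed loop this shows that each round shortens it by exactly one bit.
-/
theorem eval_of_not_writes (O : Oracle) {P : LoopProg} {r : ℕ} (h : ¬ P.Writes r) (σ : Store) :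
    P.eval O σ r = σ r := by
  induction P generalizing σ with
  | skip => rfl
  | push q b => exact Function.update_of_ne h _ _
  | pop q => exact Function.update_of_ne h _ _
  | query q q' a => exact Function.update_of_ne h _ _
  | seq P Q ihP ihQ =>
    simp only [Writes, not_or] at h
    simp [eval, ihP h.1, ihQ h.2]
  | branch q E Z U h₁ h₂ h₃ =>
    simp only [Writes, not_or] at h
    rcases hq : σ q with _ | ⟨_ | _, l⟩ <;> simp only [eval, hq]
    · exact h₁ h.1 σ
    · exact h₂ h.2.1 σ
    · exact h₃ h.2.2 σ
  | each q P ih =>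
    simp only [Writes, not_or] at h
    simp only [eval]
    generalize (σ q).length = k
    induction k generalizing σ with
    | zero => rfl
    | succ k ihk =>
      rw [Function.iterate_succ_apply, ihk, Function.update_of_ne h.1, ih h.2]

theorem eval_each_nil (O : Oracle) {P : LoopProg} {r : ℕ} {σ : Store} (h : σ r = []) :
    (each r P).eval O σ = σ := by
  simp [eval, h]

theorem eval_each_cons (O : Oracle) {P : LoopProg} {r : ℕ} (hP : ¬ P.Writes r) {σ : Store}
    {b : Bool} {l : List Bool} (h : σ r = b :: l) :
    (each r P).eval O σ = (each r P).eval O (Function.update (P.eval O σ) r l) := by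
  simp [eval, h, eval_of_not_writes O hP σ]

/-- Loop programs halt, within their time bound. -/
theorem runs (O : Oracle) {P : LoopProg} (hP : P.WF) {σ : Store} {s : ℕ}
    (hσ : ∀ r, r ≠ 1 → (σ r).length ≤ s) :
    (∃ k ≤ P.bound s, P.toMachine.Runs O σ k (P.eval O σ)) ∧
      ∀ r, r ≠ 1 → (P.eval O σ r).length ≤ P.bound s := by
  induction P generalizing σ s with
  | skip =>
    exact ⟨⟨1, by simp [bound], .skip σ⟩, fun r hr => (hσ r hr).trans (by simp [bound])⟩
  | push q b =>
    refine ⟨⟨1, by simp [bound], .push q b σ⟩, fun r hr => ?_⟩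
    have := hσ r hr
    by_cases h : r = q
    · subst h; simpa [bound, eval] using this
    · simp only [bound, eval, Function.update_of_ne h]; omega
  | pop q =>
    refine ⟨⟨1, by simp [bound], .pop q σ⟩, fun r hr => ?_⟩
    have := hσ r hr
    by_cases h : r = q
    · subst h; simp only [bound, eval, Function.update_self, List.length_tail]; omega
    · simp only [bound, eval, Function.update_of_ne h]; omega
  | query q q' a =>
    refine ⟨⟨1, by simp [bound], .query q q' a σ⟩, fun r hr => ?_⟩
    have := hσ r hr
    by_cases h : r = a
    · subst h; simpa [bound, eval] using this
    · simp only [bound, eval, Function.update_of_ne h]; omega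
  | seq P Q ihP ihQ =>
    obtain ⟨⟨k, hk, h₁⟩, h₂⟩ := ihP hP.1 hσ
    obtain ⟨⟨k', hk', h₃⟩, h₄⟩ := ihQ hP.2 h₂
    exact ⟨⟨k + k', by simp only [bound]; omega, .seq h₁ h₃⟩,
      fun r hr => (h₄ r hr).trans (by simp only [bound]; omega)⟩
  | branch q E Z U ihE ihZ ihU =>
    rcases h : σ q with _ | ⟨_ | _, l⟩
    · obtain ⟨⟨k, hk, h₁⟩, h₂⟩ := ihE hP.1 hσ
      have e : (branch q E Z U).eval O σ = E.eval O σ := by simp [eval, h]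
      rw [e]
      exact ⟨⟨k + 1, by simp only [bound]; omega, .branch_empty h h₁⟩,
        fun r hr => (h₂ r hr).trans (by simp only [bound]; omega)⟩
    · obtain ⟨⟨k, hk, h₁⟩, h₂⟩ := ihZ hP.2.1 hσ
      have e : (branch q E Z U).eval O σ = Z.eval O σ := by simp [eval, h]
      rw [e]
      exact ⟨⟨k + 1, by simp only [bound]; omega, .branch_zero (by simp [h]) h₁⟩,
        fun r hr => (h₂ r hr).trans (by simp only [bound]; omega)⟩
    · obtain ⟨⟨k, hk, h₁⟩, h₂⟩ := ihU hP.2.2 hσ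
      have e : (branch q E Z U).eval O σ = U.eval O σ := by simp [eval, h]
      rw [e]
      exact ⟨⟨k + 1, by simp only [bound]; omega, .branch_one (by simp [h]) h₁⟩,
        fun r hr => (h₂ r hr).trans (by simp only [bound]; omega)⟩
  | each q P ih =>
    obtain ⟨hP, hq, hq1⟩ := hP
    -- Induction on the number j of rounds left, for every height bound a: one round replaces a by
    -- `P.bound a`. Stack 1 is exempt because the data may be arbitrarily long compared with the
    -- input.
    have key : ∀ (j : ℕ) (τ : Store) (a : ℕ), (τ q).length = j →
        (∀ r, r ≠ 1 → (τ r).length ≤ a) →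
        (∃ k ≤ j * ((P.bound^[j]) a + 2) + 1,
          (each q P).toMachine.Runs O τ k ((each q P).eval O τ)) ∧
        ∀ r, r ≠ 1 → ((each q P).eval O τ r).length ≤ (P.bound^[j]) a := by
      intro j
      induction j with
      | zero =>
        intro τ a hj ha
        have h0 : τ q = [] := List.length_eq_zero_iff.1 hj
        rw [eval_each_nil O h0]
        exact ⟨⟨1, by simp, .loop_done h0⟩, by simpa using ha⟩
      | succ j ihj =>
        intro τ a hj ha
        obtain ⟨b, l, hl⟩ := List.exists_cons_of_length_eq_add_one hj
        obtain ⟨⟨k, hk, h₁⟩, h₂⟩ := ih hP ha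
        have hτ : P.eval O τ q = b :: l := by rw [eval_of_not_writes O hq, hl]
        have hpop : (Machine.pop q).Runs O (P.eval O τ) 1
            (Function.update (P.eval O τ) q l) := by
          have := Machine.Runs.pop (O := O) q (P.eval O τ)
          rwa [hτ, List.tail_cons] at this
        obtain ⟨⟨k', hk', h₃⟩, h₄⟩ := ihj (Function.update (P.eval O τ) q l) (P.bound a)
          (by simp_all) (by
            intro r hr
            by_cases e : r = q
            · subst e
              have := h₂ r hr
              simp [hτ] at this ⊢
              omega
            · rw [Function.update_of_ne e]; exact h₂ r hr)
        rw [eval_each_cons O hq hl]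
        refine ⟨⟨(k + 1) + k' + 1, ?_, .loop_again (by simp [hl]) (.seq h₁ hpop) h₃⟩, ?_⟩
        · rw [Function.iterate_succ_apply]
          have : P.bound a ≤ (P.bound^[j]) (P.bound a) :=
            Function.id_le_iterate_of_id_le (fun x => P.le_bound x) j _
          have e : (j + 1) * ((P.bound^[j]) (P.bound a) + 2) =
            j * ((P.bound^[j]) (P.bound a) + 2) + (P.bound^[j]) (P.bound a) + 2 := by ring
          omega
        · rw [Function.iterate_succ_apply]; exact h₄
    obtain ⟨⟨k, hk, h₁⟩, h₂⟩ := key _ σ s rfl hσ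
    -- Since the counter is not stack 1, there are at most s rounds.
    have hle : (P.bound^[(σ q).length]) s ≤ (P.bound^[s]) s :=
      Function.monotone_iterate_of_id_le (fun x => P.le_bound x) (hσ q hq1) s
    have hmul : (σ q).length * ((P.bound^[(σ q).length]) s + 2) ≤ s * ((P.bound^[s]) s + 2) :=
      Nat.mul_le_mul (hσ q hq1) (by omega)
    exact ⟨⟨k, by simp only [bound]; omega, h₁⟩,
      fun r hr => (h₂ r hr).trans (by simp only [bound]; omega)⟩

end LoopProg

/-! ### Primitive recursive functions by loop programs -/

/-- A natural number in unary notation. -/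
abbrev un (k : ℕ) : List Bool := List.replicate k true

theorem un_succ (k : ℕ) : true :: un k = un (k + 1) := rfl

namespace LoopProg

/-- If `S j` describes the stacks after `j` rounds, then `S k` describes them after a loop of `k`
rounds. -/
theorem eval_each_eq (O : Oracle) {P : LoopProg} {r : ℕ} (S : ℕ → Store) (k : ℕ)
    (hk : (S 0 r).length = k)
    (hS : ∀ j < k, update (P.eval O (S j)) r (P.eval O (S j) r).tail = S (j + 1)) :
    (each r P).eval O (S 0) = S k := by
  simp only [eval, hk]
  have : ∀ j ≤ k, (fun τ => update (P.eval O τ) r (P.eval O τ r).tail)^[j] (S 0) = S j := by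
    intro j
    induction j with
    | zero => intro _; rfl
    | succ j ih =>
      intro hj
      rw [Function.iterate_succ_apply', ih (by omega), hS j (by omega)]
  exact this k le_rfl

/-- Empty the stack `r`. -/
def clear (r : ℕ) : LoopProg := each r skip

/-- Add the number in `src` to the one in `dst`, and empty `src`. -/
def move (src dst : ℕ) : LoopProg := each src (push dst true)

/-- Copy the number in `src` to the empty stack `dst`; the stack `dst + 1` has to be empty. -/
def copy (src dst : ℕ) : LoopProg :=
  seq (each src (seq (push dst true) (push (dst + 1) true))) (move (dst + 1) src)

theorem eval_clear (O : Oracle) (r : ℕ) (σ : Store) :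
    (clear r).eval O σ = update σ r [] := by
  have h := eval_each_eq O (P := skip) (r := r) (fun j => update σ r ((σ r).drop j)) (σ r).length
    (by simp) (by intro j hj; simp [eval])
  simpa [clear] using h

theorem eval_move (O : Oracle) {src dst : ℕ} (hne : src ≠ dst) {σ : Store} {a b : ℕ}
    (ha : σ src = un a) (hb : σ dst = un b) :
    (move src dst).eval O σ = update (update σ src []) dst (un (b + a)) := by
  have h := eval_each_eq O (P := push dst true) (r := src)
    (fun j => update (update σ src (un (a - j))) dst (un (b + j))) a
    (by simp [Function.update_of_ne hne]) (by
      intro j hj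
      funext r
      simp only [eval, Function.update_apply]
      split_ifs <;> first | omega | rfl | (simp_all; done) | (simp; omega))
  have e : update (update σ src (un (a - 0))) dst (un (b + 0)) = σ := by
    rw [Nat.sub_zero, Nat.add_zero, ← ha, ← hb]; simp
  simp only [e] at h
  simpa [move] using h

theorem eval_copy (O : Oracle) {src dst : ℕ} (h₁ : src ≠ dst) (h₂ : src ≠ dst + 1) {σ : Store}
    {a : ℕ} (ha : σ src = un a) (hd : σ dst = []) (hd' : σ (dst + 1) = []) :
    (copy src dst).eval O σ = update σ dst (un a) := by
  have h := eval_each_eq O (P := seq (push dst true) (push (dst + 1) true)) (r := src)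
    (fun j => update (update (update σ src (un (a - j))) dst (un j)) (dst + 1) (un j)) a
    (by simp [h₁, h₂]) (by
      intro j hj
      funext r
      simp only [eval, Function.update_apply]
      split_ifs <;> first | omega | (simp_all [List.replicate_succ]; done) | (simp; omega))
  have e : update (update (update σ src (un (a - 0))) dst (un 0)) (dst + 1) (un 0) = σ := by
    rw [Nat.sub_zero, ← ha]; funext r; simp only [Function.update_apply]; split_ifs <;> simp_all
  simp only [e] at h
  simp only [copy, eval] at h ⊢
  -- The first loop has emptied `src`; it is restored from the second copy in `dst + 1`.
  rw [h, eval_move O h₂.symm (a := a) (b := 0) (by simp) (by simp [h₁, h₂])]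
  funext r; simp only [Function.update_apply]; split_ifs <;> simp_all

/-- `P` computes `f` from the numbers in the stacks `a i` into the stack `out`, provided that the
stacks from `out` on are empty. -/
structure Computes (P : LoopProg) {n : ℕ} (f : List.Vector ℕ n → ℕ) (a : Fin n → ℕ) (out : ℕ) :
    Prop where
  wf : P.WF
  writes : ∀ r, P.Writes r → out ≤ r ∨ ∃ i, r = a i
  eval_eq : ∀ (O : Oracle) (σ : Store) (v : List.Vector ℕ n), (∀ i, σ (a i) = un (v.get i)) →
    (∀ r, out ≤ r → σ r = []) → P.eval O σ = update σ out (un (f v))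

/-- Empty `k` stacks, from `r` on. -/
def clearFrom (r : ℕ) : ℕ → LoopProg
  | 0 => skip
  | k + 1 => seq (clearFrom r k) (clear (r + k))

theorem wf_clearFrom {r : ℕ} (hr : 1 < r) (k : ℕ) : (clearFrom r k).WF := by
  induction k with
  | zero => trivial
  | succ k ih => exact ⟨ih, trivial, id, by omega⟩

theorem le_of_writes_clearFrom {r k s : ℕ} (h : (clearFrom r k).Writes s) : r ≤ s := by
  induction k with
  | zero => exact h.elim
  | succ k ih =>
    rcases h with h | h | h
    · exact ih h
    · omega
    · exact h.elim

theorem eval_clearFrom (O : Oracle) (r k : ℕ) (σ : Store) :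
    (clearFrom r k).eval O σ = fun s => if r ≤ s ∧ s < r + k then [] else σ s := by
  induction k with
  | zero => funext s; simp only [clearFrom, eval]; rw [if_neg (by omega)]
  | succ k ih =>
    funext s
    simp only [clearFrom, eval, eval_clear, ih, Function.update_apply]
    split_ifs <;> first | rfl | omega

/-- The components are evaluated one after the other, the i-th into `out + i`. Each needs empty
stacks only from its own output on, so the earlier results survive. The induction is on the number k
of components done. -/
theorem exists_computes_tuple {m : ℕ} {a : Fin m → ℕ} {out : ℕ} (ha : ∀ i, a i < out)
    {n : ℕ} (g : Fin n → List.Vector ℕ m → ℕ)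
    (hg : ∀ (i : Fin n) (out' : ℕ), out ≤ out' → ∃ P, Computes P (g i) a out')
    (k : ℕ) (hk : k ≤ n) :
    ∃ P : LoopProg, P.WF ∧ (∀ r, P.Writes r → out ≤ r ∨ ∃ i, r = a i) ∧
      ∀ (O : Oracle) (σ : Store) (v : List.Vector ℕ m), (∀ i, σ (a i) = un (v.get i)) →
        (∀ r, out ≤ r → σ r = []) → P.eval O σ = fun r =>
          if h : out ≤ r ∧ r < out + k then un (g ⟨r - out, by omega⟩ v) else σ r := by
  induction k with
  | zero =>
    refine ⟨skip, trivial, fun r h => h.elim, fun O σ v _ _ => ?_⟩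
    funext r
    rw [dif_neg (by omega)]; rfl
  | succ k ih =>
    obtain ⟨P, hP, hPw, hPe⟩ := ih (by omega)
    obtain ⟨Q, hQ⟩ := hg ⟨k, hk⟩ (out + k) (by omega)
    refine ⟨seq P Q, ⟨hP, hQ.wf⟩, ?_, fun O σ v hv he => ?_⟩
    · rintro r (h | h)
      · exact hPw r h
      · rcases hQ.writes r h with h | h
        · left; omega
        · exact .inr h
    · simp only [eval]
      rw [hQ.eval_eq O _ v, hPe O σ v hv he]
      · funext r
        simp only [Function.update_apply]
        by_cases h : r = out + k
        · subst h; simp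
        · rw [if_neg h]
          by_cases h' : out ≤ r ∧ r < out + k
          · rw [dif_pos h', dif_pos (by omega)]
          · rw [dif_neg h', dif_neg (by omega)]
      · intro i
        rw [hPe O σ v hv he]
        have := ha i
        simp only
        rw [dif_neg (by omega), hv]
      · intro r hr
        rw [hPe O σ v hv he]
        simp only
        rw [dif_neg (by omega), he r (by omega)]

/-- Primitive recursive functions are computed by loop programs. -/
theorem exists_computes {n : ℕ} {f : List.Vector ℕ n → ℕ} (hf : Nat.Primrec' f) :
    ∀ (a : Fin n → ℕ) (out : ℕ), (∀ i, a i < out) → (∀ i, a i ≠ 1) → 1 < out →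
      ∃ P, Computes P f a out := by
  induction hf with
  | zero =>
    intro a out ha ha1 hout
    refine ⟨skip, trivial, fun r h => h.elim, fun O σ v hv he => ?_⟩
    simp [eval, ← he out le_rfl]
  | succ =>
    intro a out ha ha1 hout
    have h0 := ha 0
    refine ⟨seq (copy (a 0) out) (push out true), ⟨⟨⟨⟨trivial, trivial⟩, ?_, ha1 0⟩, trivial, ?_, ?_⟩, trivial⟩, ?_, ?_⟩
    · simp only [Writes]; omega
    · simp only [Writes]; omega
    · omega
    · intro r hr
      simp only [copy, move, Writes] at hr
      rcases hr with ((h | h | h) | h | h) | h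
      all_goals first | (left; omega) | exact .inr ⟨0, h⟩
    · intro O σ v hv he
      simp only [eval]
      rw [eval_copy O (by omega) (by omega) (hv 0) (he _ le_rfl) (he _ (by omega))]
      simp [un_succ]
  | get i =>
    intro a out ha ha1 hout
    have h0 := ha i
    refine ⟨copy (a i) out, ⟨⟨⟨trivial, trivial⟩, ?_, ha1 i⟩, trivial, ?_, ?_⟩, ?_, ?_⟩
    · simp only [Writes]; omega
    · simp only [Writes]; omega
    · omega
    · intro r hr
      simp only [copy, move, Writes] at hr
      rcases hr with (h | h | h) | h | h
      all_goals first | (left; omega) | exact .inr ⟨i, h⟩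
    · intro O σ v hv he
      exact eval_copy O (by omega) (by omega) (hv i) (he _ le_rfl) (he _ (by omega))
  | @comp m n f g _ _ ihf ihg =>
    intro a out ha ha1 hout
    -- Stack `out` is kept free: the values of `g` go to `out + 1, …, out + n`, that of `f` to `out
    -- + 1 + n`, from where it is moved to `out`.
    obtain ⟨P, hP, hPw, hPe⟩ := exists_computes_tuple (a := a) (out := out + 1)
      (fun i => (ha i).trans (by omega)) g
      (fun i out' ho => ihg i a out' (fun j => (ha j).trans (by omega)) ha1 (by omega)) n le_rfl
    obtain ⟨Q, hQ⟩ := ihf (fun i => out + 1 + i) (out + 1 + n) (fun i => by omega)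
      (fun i => by omega) (by omega)
    refine ⟨seq P (seq Q (seq (move (out + 1 + n) out) (clearFrom (out + 1) n))),
      ⟨hP, hQ.wf, ⟨trivial, ?_, ?_⟩, wf_clearFrom (by omega) n⟩, ?_, ?_⟩
    · simp only [Writes]; omega
    · omega
    · rintro r (h | h | (h | h) | h)
      · rcases hPw r h with h | h
        · left; omega
        · exact .inr h
      · rcases hQ.writes r h with h | ⟨i, h⟩ <;> (left; omega)
      · left; omega
      · simp only [Writes] at h; left; omega
      · have := le_of_writes_clearFrom h; left; omega
    · intro O σ v hv he
      simp only [eval]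
      rw [hPe O σ v hv (fun r hr => he r (by omega))]
      rw [hQ.eval_eq O _ (List.Vector.ofFn fun i => g i v)]
      · rw [eval_move O (by omega) (a := f (List.Vector.ofFn fun i => g i v)) (b := 0) (by simp)
          (by rw [Function.update_of_ne (by omega), dif_neg (by omega), he _ le_rfl]; rfl)]
        rw [eval_clearFrom]
        funext r
        simp only [Function.update_apply]
        split_ifs <;> first | rfl | omega | exact (he r (by omega)).symm | simp
      · intro i
        simp
      · intro r hr
        rw [dif_neg (by omega), he r (by omega)]
  | @prec n f g _ _ ihf ihg =>
    intro a out ha ha1 hout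
    obtain ⟨P, hP⟩ := ihf (fun i => a i.succ) out (fun i => ha _) (fun i => ha1 _) hout
    -- Layout of the recursion: `out` holds the current value, `out + 1` the number of rounds left,
    -- `out + 2` the recursion index, and `out + 3` receives the next value.
    obtain ⟨Q, hQ⟩ := ihg (Fin.cons (out + 2) (Fin.cons out fun i => a i.succ)) (out + 3)
      (by
        intro i
        refine Fin.cases ?_ (fun i => Fin.cases ?_ (fun i => ?_) i) i
        · simp
        · simp
        · have := ha i.succ; simp; omega)
      (by
        intro i
        refine Fin.cases ?_ (fun i => Fin.cases ?_ (fun i => ?_) i) i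
        · simp
        · simp; omega
        · simpa using ha1 _)
      (by omega)
    have hQw : ∀ r, Q.Writes r → out + 3 ≤ r ∨ r = out + 2 ∨ r = out ∨ ∃ i, r = a i := by
      intro r h
      rcases hQ.writes r h with h | ⟨i, h⟩
      · exact .inl h
      · right
        revert h
        refine Fin.cases ?_ (fun i => Fin.cases ?_ (fun i => ?_) i) i
        · simp +contextual
        · simp +contextual
        · intro h; exact .inr (.inr ⟨i.succ, by simpa using h⟩)
    refine ⟨seq P (seq (copy (a 0) (out + 1)) (seq (each (out + 1)
      (seq Q (seq (clear out) (seq (move (out + 3) out) (push (out + 2) true)))))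
      (clear (out + 2)))), ?_, ?_, ?_⟩
    · have h0 := ha 0
      refine ⟨hP.wf, ⟨⟨⟨trivial, trivial⟩, ?_, ha1 0⟩, trivial, ?_, ?_⟩,
        ⟨⟨hQ.wf, ⟨trivial, id, ?_⟩, ⟨trivial, ?_, ?_⟩, trivial⟩, ?_, ?_⟩, trivial, id, ?_⟩
      all_goals first | omega | (simp only [Writes]; omega) | skip
      rintro (h | h)
      · rcases hQw _ h with h | h | h | ⟨i, h⟩
        · omega
        · omega
        · omega
        · have := ha i; omega
      · simp [clear, move, Writes] at h
    · intro r hr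
      simp only [copy, clear, move, Writes] at hr
      rcases hr with h | ((h | h | h) | h | h) | (h | h | (h | h) | (h | h) | h) | (h | h)
      · rcases hP.writes r h with h | ⟨i, h⟩
        · exact .inl h
        · exact .inr ⟨_, h⟩
      all_goals try first | exact h.elim | (left; omega) | exact .inr ⟨0, h⟩
      rcases hQw r h with h | h | h | h
      · left; omega
      · left; omega
      · left; omega
      · exact .inr h
    · intro O σ v hv he
      simp only [eval]
      rw [hP.eval_eq O σ v.tail (fun i => by simpa [List.Vector.get_tail_succ] using hv i.succ) he]
      have h0 := ha 0
      rw [eval_copy O (by omega) (by omega) (a := v.head)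
        (by rw [Function.update_of_ne (by omega), hv 0, List.Vector.get_zero])
        (by rw [Function.update_of_ne (by omega), he _ (by omega)])
        (by rw [Function.update_of_ne (by omega), he _ (by omega)])]
      have key := eval_each_eq O (r := out + 1)
        (P := seq Q (seq (clear out) (seq (move (out + 3) out) (push (out + 2) true))))
        (fun j => update (update (update σ out
          (un (j.rec (f v.tail) fun y IH => g (y ::ᵥ IH ::ᵥ v.tail)))) (out + 1)
          (un (v.head - j))) (out + 2) (un j)) v.head (by simp) (by
          intro j hj
          simp only [eval, eval_clear]
          rw [hQ.eval_eq O _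
            (j ::ᵥ (j.rec (f v.tail) fun y IH => g (y ::ᵥ IH ::ᵥ v.tail)) ::ᵥ v.tail)]
          · rw [eval_move O (a := g (j ::ᵥ (j.rec (f v.tail) fun y IH => g (y ::ᵥ IH ::ᵥ v.tail))
              ::ᵥ v.tail)) (b := 0) (by omega) (by simp) (by simp)]
            have h3 := he (out + 3) (by omega)
            funext r
            simp only [Function.update_apply]
            split_ifs <;> first | omega | (simp_all [List.replicate_succ]; done) | (simp; omega)
          · intro i
            refine Fin.cases ?_ (fun i => Fin.cases ?_ (fun i => ?_) i) i
            · simp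
            · simp only [Fin.cons_succ, Fin.cons_zero, List.Vector.get_cons_succ,
                List.Vector.get_cons_zero]
              rw [Function.update_of_ne (by omega), Function.update_of_ne (by omega),
                Function.update_self]
            · have h1 := ha i.succ
              simp only [Fin.cons_succ, List.Vector.get_cons_succ]
              rw [Function.update_of_ne (by omega), Function.update_of_ne (by omega),
                Function.update_of_ne (by omega), hv, List.Vector.get_tail_succ]
          · intro r hr
            rw [Function.update_of_ne (by omega), Function.update_of_ne (by omega),
                Function.update_of_ne (by omega), he r (by omega)])
      have e : ∀ y : List Bool, update (update (update σ out y) (out + 1) (un v.head)) (out + 2)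
          (un 0) = update (update σ out y) (out + 1) (un v.head) := by
        intro y
        have h2 := he (out + 2) (by omega)
        funext r; simp only [Function.update_apply]; split_ifs <;> simp_all
      simp only [Nat.sub_zero, Nat.sub_self, e, Nat.rec_zero] at key
      simp only [eval] at key
      rw [key, eval_clear]
      funext r
      simp only [Function.update_apply]
      split_ifs <;> first | rfl | omega | exact (he r (by omega)).symm

end LoopProg

/-! ### Reading input, data and oracle answers into numbers -/

/-- The number with the given binary digits, the most significant one first. -/
def binVal (l : List Bool) : ℕ := l.foldl (fun x b => 2 * x + b.toNat) 0

/-- The value `x` after reading the top of a stack as a further binary digit. -/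
def readStep (x : ℕ) : List Bool → ℕ
  | [] => x
  | b :: _ => 2 * x + b.toNat

/-- One round of Horner's scheme. Past the end of l nothing changes, so a reading loop may make more
rounds than there are digits. -/
theorem readStep_drop (l : List Bool) (j : ℕ) :
    readStep (binVal (l.take j)) (l.drop j) = binVal (l.take (j + 1)) := by
  by_cases h : j < l.length
  · rw [List.drop_eq_getElem_cons h, List.take_succ_eq_append_getElem h]
    simp only [readStep, binVal, List.foldl_append, List.foldl_cons, List.foldl_nil]
  · rw [List.drop_eq_nil_of_le (by omega), List.take_of_length_le (by omega),
      List.take_of_length_le (by omega)]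
    rfl

/-- The digits `b (k - 1), …, b 0`. -/
def digits (b : ℕ → Bool) : ℕ → List Bool
  | 0 => []
  | k + 1 => b k :: digits b k

/-- The answers of the oracle to the first `k` pairs of words of length `n`, as a number. -/
def answers (O : Oracle) (n : ℕ) : ℕ → ℕ
  | 0 => 0
  | i + 1 => answers O n i +
      if O (digits (i / 2 ^ n).testBit n) (digits (i % 2 ^ n).testBit n) then 2 ^ i else 0

/-- Output values as numbers. -/
def outOf : ℕ → Option Bool
  | 0 => none
  | 1 => some false
  | _ + 2 => some true

theorem primrec_two_pow : Primrec fun k : ℕ => 2 ^ k :=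
  (Primrec.nat_rec₁ 1 (f := fun _ x => 2 * x) (Primrec.nat_double.comp Primrec.snd).to₂).of_eq
    fun k => by induction k with
      | zero => rfl
      | succ k ih => simp only [ih]; ring

namespace LoopProg

/-- A program that may change the stack `dst`, the inputs `a i` and the stacks from `B` on. -/
structure Assigns (P : LoopProg) {n : ℕ} (f : List.Vector ℕ n → ℕ) (a : Fin n → ℕ) (dst B : ℕ) :
    Prop where
  wf : P.WF
  writes : ∀ r, P.Writes r → B ≤ r ∨ r = dst ∨ ∃ i, r = a i
  eval_eq : ∀ (O : Oracle) (σ : Store) (v : List.Vector ℕ n), (∀ i, σ (a i) = un (v.get i)) →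
    (∀ r, B ≤ r → σ r = []) → P.eval O σ = update σ dst (un (f v))

/-- The value is built in the scratch stack B and only then moved, so `dst` may be one of the
inputs, as in x := 2x + 1. -/
theorem exists_assigns {n : ℕ} {f : List.Vector ℕ n → ℕ} (hf : Primrec f) (a : Fin n → ℕ)
    (dst B : ℕ) (ha : ∀ i, a i < B) (ha1 : ∀ i, a i ≠ 1) (hd : dst < B) (hd1 : dst ≠ 1)
    (hB : 1 < B) : ∃ P, Assigns P f a dst B := by
  obtain ⟨P, hP⟩ := exists_computes (Nat.Primrec'.prim_iff.2 hf) a B ha ha1 hB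
  refine ⟨seq P (seq (clear dst) (move B dst)), ⟨hP.wf, ⟨trivial, id, hd1⟩, trivial, ?_, ?_⟩,
    ?_, ?_⟩
  · simp only [Writes]; omega
  · omega
  · rintro r (h | (h | h) | h | h)
    · rcases hP.writes r h with h | h
      · exact .inl h
      · exact .inr (.inr h)
    · exact .inr (.inl h)
    · exact h.elim
    · left; omega
    · exact .inr (.inl h)
  · intro O σ v hv he
    simp only [eval, eval_clear]
    rw [hP.eval_eq O σ v hv he, eval_move O (a := f v) (b := 0) (by omega)
      (by rw [Function.update_of_ne (by omega), Function.update_self]) (by simp)]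
    funext r
    have := he r
    simp only [Function.update_apply]
    split_ifs <;> first | omega | simp_all

/-- The program only inspects the top of `src`; removing it is left to the surrounding loop. -/
theorem exists_readBit (src dst B : ℕ) (hd : dst < B) (hd1 : dst ≠ 1)
    (hB : 1 < B) : ∃ P : LoopProg, P.WF ∧ (∀ r, P.Writes r → B ≤ r ∨ r = dst) ∧
      ∀ (O : Oracle) (σ : Store) (x : ℕ), σ dst = un x → (∀ r, B ≤ r → σ r = []) →
        P.eval O σ = update σ dst (un (readStep x (σ src))) := by
  obtain ⟨P, hP⟩ := exists_assigns (n := 1) (f := fun v => 2 * v.get 0)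
    (Primrec.nat_double.comp (Primrec.vector_get.comp Primrec.id (Primrec.const 0)))
    (fun _ => dst) dst B (fun _ => hd) (fun _ => hd1) hd hd1 hB
  obtain ⟨Q, hQ⟩ := exists_assigns (n := 1) (f := fun v => 2 * v.get 0 + 1)
    (Primrec.nat_double_succ.comp (Primrec.vector_get.comp Primrec.id (Primrec.const 0)))
    (fun _ => dst) dst B (fun _ => hd) (fun _ => hd1) hd hd1 hB
  refine ⟨branch src skip P Q, ⟨trivial, hP.wf, hQ.wf⟩, ?_, ?_⟩
  · rintro r (h | h | h)
    · exact h.elim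
    · simpa using hP.writes r h
    · simpa using hQ.writes r h
  · intro O σ x hx he
    rcases h : σ src with _ | ⟨_ | _, l⟩ <;> simp only [eval, h, readStep]
    · rw [← hx]; simp
    · rw [hP.eval_eq O σ (x ::ᵥ .nil) (by simpa using hx) he]; rfl
    · rw [hQ.eval_eq O σ (x ::ᵥ .nil) (by simpa using hx) he]; rfl

/-- The length is recorded along with the value because leading zeros are lost in the latter. -/
theorem exists_readInput : ∃ P : LoopProg, P.WF ∧
    ∀ (O : Oracle) (σ : Store), σ 3 = [] → σ 4 = [] → (∀ r, 16 ≤ r → σ r = []) →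
      P.eval O σ = update (update (update σ 0 []) 3 (un (σ 0).length)) 4 (un (binVal (σ 0))) := by
  obtain ⟨P, hP, hw, he⟩ := exists_readBit 0 4 16 (by omega) (by omega) (by omega)
  refine ⟨each 0 (seq (push 3 true) P), ⟨⟨trivial, hP⟩, ?_, by omega⟩, ?_⟩
  · rintro (h | h)
    · simp [Writes] at h
    · have := hw _ h; omega
  · intro O σ h3 h4 hc
    have key := eval_each_eq O (P := seq (push 3 true) P) (r := 0)
      (fun j => update (update (update σ 0 ((σ 0).drop j)) 3 (un j)) 4
        (un (binVal ((σ 0).take j)))) (σ 0).length (by simp) (by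
        intro j hj
        simp only [eval]
        rw [he O _ (binVal ((σ 0).take j)) (by simp)]
        · simp only [Function.update_apply, Nat.reduceEqDiff, OfNat.zero_ne_ofNat, if_true, if_false,
            readStep_drop]
          funext r
          simp only [Function.update_apply]
          split_ifs <;> first | omega | simp_all [List.replicate_succ]
        · intro r hr
          simp only [Function.update_apply]
          split_ifs <;> first | omega | exact hc r hr)
    have e : update (update (update σ 0 (List.drop 0 (σ 0))) 3 (un 0)) 4
        (un (binVal (List.take 0 (σ 0)))) = σ := by
      funext r; simp only [Function.update_apply]; split_ifs <;> simp_all [binVal]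
    simp only [e] at key
    simpa using key

/-- The counter 2n + 3 is computed from the input length, so the time does not depend on the amount
of data. It suffices, as an index of a rectangle has at most 2n + 1 digits (`clog_le_of_le`). -/
theorem exists_readData : ∃ P : LoopProg, P.WF ∧
    ∀ (O : Oracle) (σ : Store) (n : ℕ), σ 3 = un n → σ 5 = [] → (∀ r, 16 ≤ r → σ r = []) →
      P.eval O σ = update (update (update σ 6 []) 1 ((σ 1).drop (2 * n + 3))) 5
        (un (binVal ((σ 1).take (2 * n + 3)))) := by
  obtain ⟨Q, hQ⟩ := exists_assigns (n := 1) (f := fun v => 2 * v.get 0 + 3)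
    (Primrec.nat_add.comp (Primrec.nat_double.comp
      (Primrec.vector_get.comp Primrec.id (Primrec.const 0))) (Primrec.const 3))
    (fun _ => 3) 6 16 (by simp) (by simp) (by omega) (by omega) (by omega)
  obtain ⟨P, hP, hw, he⟩ := exists_readBit 1 5 16 (by omega) (by omega) (by omega)
  refine ⟨seq Q (each 6 (seq P (pop 1))), ⟨hQ.wf, ⟨hP, trivial⟩, ?_, by omega⟩, ?_⟩
  · rintro (h | h)
    · have := hw _ h; omega
    · simp [Writes] at h
  · intro O σ n h3 h5 hc
    have key := eval_each_eq O (P := seq P (pop 1)) (r := 6)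
      (fun j => update (update (update σ 6 (un (2 * n + 3 - j))) 1 ((σ 1).drop j)) 5
        (un (binVal ((σ 1).take j)))) (2 * n + 3) (by simp) (by
        intro j hj
        simp only [eval]
        rw [he O _ (binVal ((σ 1).take j)) (by simp)]
        · simp only [Function.update_apply]
          simp only [Nat.reduceEqDiff, if_true, if_false, readStep_drop, OfNat.one_ne_ofNat]
          funext r
          simp only [Function.update_apply]
          split_ifs <;> first | omega | (simp_all; done) | (simp; omega)
        · intro r hr
          simp only [Function.update_apply]
          split_ifs <;> first | omega | exact hc r hr)
    have e : update (update (update σ 6 (un (2 * n + 3 - 0))) 1 (List.drop 0 (σ 1))) 5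
        (un (binVal (List.take 0 (σ 1)))) = update σ 6 (un (2 * n + 3)) := by
      funext r; simp only [Function.update_apply]; split_ifs <;> simp_all [binVal]
    simp only [e, Nat.sub_self] at key
    change (each 6 _).eval O (Q.eval O σ) = _
    rw [hQ.eval_eq O σ (n ::ᵥ .nil) (by simpa using h3) hc]
    exact key

/-- Write a word of length `n` with computed digits on the stack `dst`. -/
theorem exists_writeWord {h : ℕ → ℕ → ℕ → ℕ}
    (hh : Primrec fun v : List.Vector ℕ 3 => h (v.get 0) (v.get 1) (v.get 2))
    (dst : ℕ) (hd : 9 < dst) (hd' : dst < 13) : ∃ P : LoopProg, P.WF ∧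
    (∀ r, P.Writes r → 13 ≤ r ∨ r = dst ∨ r = 3 ∨ r = 9) ∧
    ∀ (O : Oracle) (σ : Store) (i n : ℕ), σ 3 = un n → σ 9 = un i → σ dst = [] →
      (∀ r, 13 ≤ r → σ r = []) →
      P.eval O σ = update σ dst (digits (fun j => decide (h i n j ≠ 0)) n) := by
  -- Stack 13 becomes the loop counter, 14 holds the position j and 15 the digit. Positions are
  -- treated in increasing order, so the most significant digit ends on top, as in `digits`.
  obtain ⟨Q, hQ⟩ := exists_assigns (n := 1) (f := fun v => v.get 0)
    (Primrec.vector_get.comp Primrec.id (Primrec.const 0))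
    (fun _ => 3) 13 16 (by simp) (by simp) (by omega) (by omega) (by omega)
  obtain ⟨P, hP⟩ := exists_assigns hh ![9, 3, 14] 15 16 (by simp [Fin.forall_fin_succ])
    (by simp [Fin.forall_fin_succ]) (by omega) (by omega) (by omega)
  have hPw : ∀ r, P.Writes r → 14 ≤ r ∨ r = 3 ∨ r = 9 := by
    intro r hr
    rcases hP.writes r hr with h | h | h
    · omega
    · omega
    · simp [Fin.exists_fin_succ] at h; omega
  refine ⟨seq Q (seq (each 13 (seq P (seq (branch 15 (push dst false) skip (push dst true))
    (seq (clear 15) (push 14 true))))) (clear 14)),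
    ⟨hQ.wf, ⟨⟨hP.wf, ⟨trivial, trivial, trivial⟩, ⟨trivial, id, by omega⟩, trivial⟩, ?_, by omega⟩,
      trivial, id, by omega⟩, ?_, ?_⟩
  · rintro (h | h)
    · have := hPw _ h; omega
    · simp [Writes, clear] at h; omega
  · rintro r (h | (h | h | h) | h)
    · have := hQ.writes r h; simp at this; omega
    · omega
    · have := hPw _ h; omega
    · simp [Writes, clear] at h; omega
    · simp [Writes, clear] at h; omega
  · intro O σ i n h3 h9 hdst hc
    have h13 := hc 13 (by omega)
    have h14 := hc 14 (by omega)
    have h15 := hc 15 (by omega)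
    have key := eval_each_eq O (P := seq P (seq (branch 15 (push dst false) skip (push dst true))
        (seq (clear 15) (push 14 true)))) (r := 13)
      (fun j => update (update (update σ 13 (un (n - j))) 14 (un j)) dst
        (digits (fun j => decide (h i n j ≠ 0)) j)) n
      (by rw [Function.update_of_ne (by omega)]; simp) (by
        intro j hj
        simp only [eval]
        rw [hP.eval_eq O _ (i ::ᵥ n ::ᵥ j ::ᵥ .nil)]
        · have e : h ((i ::ᵥ n ::ᵥ j ::ᵥ .nil : List.Vector ℕ 3).get 0)
            ((i ::ᵥ n ::ᵥ j ::ᵥ .nil : List.Vector ℕ 3).get 1)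
            ((i ::ᵥ n ::ᵥ j ::ᵥ .nil : List.Vector ℕ 3).get 2) = h i n j := rfl
          simp only [e, Function.update_self, eval_clear]
          rcases e : h i n j with _ | m
          · simp only [List.replicate_zero, Function.update_apply]
            funext r
            simp only [Function.update_apply]
            split_ifs <;> first | omega | (simp_all [List.replicate_succ, digits]; done) | (simp; omega)
          · simp only [List.replicate_succ, Function.update_apply]
            funext r
            simp only [Function.update_apply]
            split_ifs <;> first | omega | (simp_all [digits]; done) | (simp; omega)
        · have h1 : (3 : ℕ) ≠ dst := by omega
          have h2 : (9 : ℕ) ≠ dst := by omega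
          have h4 : (14 : ℕ) ≠ dst := by omega
          intro t
          fin_cases t
          · simpa [Function.update_apply, h2] using h9
          · change _ = un n
            simpa [Function.update_apply, h1] using h3
          · simp only [Function.update_apply]; simp [h4]; rfl
        · intro r hr
          simp only [Function.update_apply]
          split_ifs <;> first | omega | exact hc r (by omega))
    have e : update (update (update σ 13 (un (n - 0))) 14 (un 0)) dst
        (digits (fun j => decide (h i n j ≠ 0)) 0) = update σ 13 (un n) := by
      funext r; simp only [Function.update_apply]; split_ifs <;> simp_all [digits]
    simp only [e, Nat.sub_self] at key
    change (clear 14).eval O ((each 13 _).eval O (Q.eval O σ)) = _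
    rw [hQ.eval_eq O σ (n ::ᵥ .nil) (by simpa using h3) (fun r hr => hc r (by omega))]
    refine (congrArg _ key).trans ?_
    rw [eval_clear]
    funext r
    simp only [Function.update_apply]
    split_ifs <;> first | omega | simp_all

end LoopProg

namespace LoopProg

/-- Ask the oracle about the pair of words with number `i`. -/
theorem exists_tableStep : ∃ P : LoopProg, P.WF ∧ ¬ P.Writes 8 ∧
    ∀ (O : Oracle) (σ : Store) (i n T : ℕ), σ 3 = un n → σ 7 = un T → σ 9 = un i →
      (∀ r, 10 ≤ r → σ r = []) → P.eval O σ = update (update σ 7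
        (un (T + if O (digits (i / 2 ^ n).testBit n) (digits (i % 2 ^ n).testBit n)
          then 2 ^ i else 0))) 9 (un (i + 1)) := by
  have get {k : ℕ} (i : Fin k) : Primrec fun v : List.Vector ℕ k => v.get i :=
    Primrec.vector_get.comp Primrec.id (Primrec.const i)
  have p2 {k : ℕ} (i : Fin k) : Primrec fun v : List.Vector ℕ k => 2 ^ v.get i :=
    primrec_two_pow.comp (get i)
  obtain ⟨P, hP⟩ := exists_assigns (n := 2) (f := fun v => v.get 0 + 2 ^ v.get 1)
    (Primrec.nat_add.comp (get 0) (p2 1)) ![7, 9] 7 13 (by simp [Fin.forall_fin_succ])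
    (by simp [Fin.forall_fin_succ]) (by omega) (by omega) (by omega)
  -- The pair with number i consists of the words with numbers i / 2^n and i % 2^n.
  obtain ⟨X, hX, hXw, hXe⟩ := exists_writeWord (h := fun i n j => i / 2 ^ n / 2 ^ j % 2)
    (Primrec.nat_mod.comp (Primrec.nat_div.comp (Primrec.nat_div.comp (get 0) (p2 1)) (p2 2))
      (Primrec.const 2)) 10 (by omega) (by omega)
  obtain ⟨Y, hY, hYw, hYe⟩ := exists_writeWord (h := fun i n j => i % 2 ^ n / 2 ^ j % 2)
    (Primrec.nat_mod.comp (Primrec.nat_div.comp (Primrec.nat_mod.comp (get 0) (p2 1)) (p2 2))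
      (Primrec.const 2)) 11 (by omega) (by omega)
  have hd : ∀ m n : ℕ, digits (fun j => decide (m / 2 ^ j % 2 ≠ 0)) n = digits m.testBit n := by
    intro m n
    congr 1
    funext j
    rw [Nat.testBit_eq_decide_div_mod_eq, decide_eq_decide]
    omega
  refine ⟨seq X (seq Y (seq (query 10 11 12) (seq (clear 10) (seq (clear 11)
    (seq (branch 12 skip skip P) (seq (clear 12) (push 9 true))))))), ⟨hX, hY, trivial, ⟨trivial, id, by omega⟩,
    ⟨trivial, id, by omega⟩, ⟨trivial, trivial, hP.wf⟩, ⟨trivial, id, by omega⟩, trivial⟩, ?_, ?_⟩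
  · rintro (h | h | h | h | h | h | h | h)
    · have := hXw _ h; omega
    · have := hYw _ h; omega
    · simp [Writes] at h
    · simp [Writes, clear] at h
    · simp [Writes, clear] at h
    · rcases h with h | h | h
      · exact h
      · exact h
      · simpa [Fin.exists_fin_succ] using hP.writes _ h
    · simp [Writes, clear] at h
    · simp [Writes] at h
  · intro O σ i n T h3 h7 h9 hc
    have h10 := hc 10 (by omega)
    have h11 := hc 11 (by omega)
    have h12 := hc 12 (by omega)
    simp only [eval, eval_clear]
    rw [hXe O σ i n h3 h9 h10 (fun r hr => hc r (by omega)), hYe O _ i n (by simpa using h3)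
      (by simpa using h9) (by simpa using h11) (fun r hr => by
        rw [Function.update_of_ne (by omega)]; exact hc r (by omega)), hd, hd]
    simp only [Function.update_apply, Nat.reduceEqDiff, if_true, if_false, h12]
    rcases e : O (digits (i / 2 ^ n).testBit n) (digits (i % 2 ^ n).testBit n)
    · simp only
      funext r
      simp only [Function.update_apply]
      split_ifs <;> first | omega | simp_all [List.replicate_succ]
    · simp only
      rw [hP.eval_eq O _ (T ::ᵥ i ::ᵥ .nil)]
      · have e : (T ::ᵥ i ::ᵥ .nil : List.Vector ℕ 2).get 0 +
          2 ^ (T ::ᵥ i ::ᵥ .nil : List.Vector ℕ 2).get 1 = T + 2 ^ i := rfl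
        simp only [e, if_true]
        funext r
        simp only [Function.update_apply]
        split_ifs <;> first | omega | simp_all [List.replicate_succ]
      · intro t
        fin_cases t
        · simpa [Function.update_apply] using h7
        · change _ = un i
          simpa [Function.update_apply] using h9
      · intro r hr
        simp only [Function.update_apply]
        split_ifs <;> first | omega | exact hc r (by omega)

/-- Stack 8 counts down the 2^n · 2^n queries, 9 is the number of the current pair, and 7
accumulates the answers. -/
theorem exists_table : ∃ P : LoopProg, P.WF ∧
    ∀ (O : Oracle) (σ : Store) (n : ℕ), σ 3 = un n → (∀ r, 7 ≤ r → σ r = []) →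
      P.eval O σ = update (update σ 7 (un (answers O n (2 ^ n * 2 ^ n)))) 9
        (un (2 ^ n * 2 ^ n)) := by
  have get {k : ℕ} (i : Fin k) : Primrec fun v : List.Vector ℕ k => v.get i :=
    Primrec.vector_get.comp Primrec.id (Primrec.const i)
  have p2 {k : ℕ} (i : Fin k) : Primrec fun v : List.Vector ℕ k => 2 ^ v.get i :=
    primrec_two_pow.comp (get i)
  obtain ⟨Q, hQ⟩ := exists_assigns (n := 1) (f := fun v => 2 ^ v.get 0 * 2 ^ v.get 0)
    (Primrec.nat_mul.comp (p2 0) (p2 0))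
    (fun _ => 3) 8 16 (by simp) (by simp) (by omega) (by omega) (by omega)
  obtain ⟨body, hwf, hw, hbody⟩ := exists_tableStep
  refine ⟨seq Q (each 8 body), ⟨hQ.wf, hwf, hw, by omega⟩, ?_⟩
  · intro O σ n h3 hc
    have h7 := hc 7 (by omega)
    have h8 := hc 8 (by omega)
    have h9 := hc 9 (by omega)
    have key := eval_each_eq O (P := body) (r := 8)
      (fun j => update (update (update σ 8 (un (2 ^ n * 2 ^ n - j))) 7 (un (answers O n j))) 9
        (un j)) (2 ^ n * 2 ^ n) (by simp) (by
        intro j hj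
        rw [hbody O _ j n (answers O n j) (by simpa using h3) (by simp) (by simp)]
        · generalize 2 ^ n * 2 ^ n = N at hj
          have e : (un (N - j)).tail = un (N - (j + 1)) := by simp; omega
          funext r
          by_cases r9 : r = 9
          · subst r9; simp
          by_cases r7 : r = 7
          · subst r7; simp [answers]
          by_cases r8 : r = 8
          · subst r8
            simpa using e
          · simp [Function.update_of_ne, r7, r8, r9]
        · intro r hr
          simp only [Function.update_apply]
          split_ifs <;> first | omega | exact hc r (by omega))
    have e : update (update (update σ 8 (un (2 ^ n * 2 ^ n - 0))) 7 (un (answers O n 0))) 9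
        (un 0) = update σ 8 (un (2 ^ n * 2 ^ n)) := by
      funext r; simp only [Function.update_apply]; split_ifs <;> simp_all [answers]
    simp only [e, Nat.sub_self] at key
    change (each 8 _).eval O (Q.eval O σ) = _
    rw [hQ.eval_eq O σ (n ::ᵥ .nil) (by simpa using h3) (fun r hr => hc r (by omega))]
    refine key.trans ?_
    funext r
    simp only [Function.update_apply]
    split_ifs <;> first | omega | simp_all

/-- A loop program that reads its input and the beginning of its data, asks the oracle about all
pairs of words of the length of the input, and outputs a given primitive recursive function of
what it has learned. -/
theorem exists_evaluator {F : ℕ → ℕ → ℕ → ℕ → ℕ}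
    (hF : Primrec fun v : List.Vector ℕ 4 => F (v.get 0) (v.get 1) (v.get 2) (v.get 3)) :
    ∃ P : LoopProg, P.WF ∧ ∀ (O : Oracle) (u d : List Bool),
      P.eval O (initStore u d) 2 = outputWord (outOf (F u.length (binVal u)
        (binVal (d.take (2 * u.length + 3)))
        (answers O u.length (2 ^ u.length * 2 ^ u.length)))) := by
  obtain ⟨P₁, h₁, e₁⟩ := exists_readInput
  obtain ⟨P₂, h₂, e₂⟩ := exists_readData
  obtain ⟨P₃, h₃, e₃⟩ := exists_table
  obtain ⟨Q, hQ⟩ := exists_assigns hF ![3, 4, 5, 7] 15 16 (by simp [Fin.forall_fin_succ])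
    (by simp [Fin.forall_fin_succ]) (by omega) (by omega) (by omega)
  refine ⟨seq P₁ (seq P₂ (seq P₃ (seq Q (branch 15 skip skip (seq (pop 15)
    (branch 15 (push 2 false) skip (push 2 true))))))), ⟨h₁, h₂, h₃, hQ.wf, trivial, trivial,
    trivial, trivial, trivial, trivial⟩, fun O u d => ?_⟩
  -- For the result 0 stack 2 stays empty, which means ⊥; otherwise one pop tells 1 from larger
  -- results.
  have key : ∀ (x : ℕ) (τ : Store), τ 2 = [] → (branch 15 skip skip (seq (pop 15)
      (branch 15 (push 2 false) skip (push 2 true)))).eval O (update τ 15 (un x)) 2 =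
        outputWord (outOf x) := by
    intro x τ hτ
    rcases x with _ | _ | x <;> simp [eval, outOf, outputWord, hτ, List.replicate_succ]
  change (branch 15 _ _ _).eval O (Q.eval O (P₃.eval O (P₂.eval O (P₁.eval O _)))) 2 = _
  have hi : ∀ r, 2 ≤ r → initStore u d r = [] := by
    intro r hr
    simp only [initStore]
    rw [if_neg (by omega), if_neg (by omega)]
  rw [e₁ O _ (hi _ (by omega)) (hi _ (by omega)) (fun r hr => hi r (by omega))]
  have i0 : initStore u d 0 = u := rfl
  have i1 : initStore u d 1 = d := rfl
  rw [e₂ O _ u.length (by simp [i0]) (by simpa using hi 5 (by omega)) (fun r hr => by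
    simp only [Function.update_apply]
    split_ifs <;> first | omega | exact hi r (by omega))]
  rw [e₃ O _ u.length (by simp [i0]) (fun r hr => by
    simp only [Function.update_apply]
    split_ifs <;> first | omega | exact hi r (by omega))]
  simp only [i0]
  rw [hQ.eval_eq O _ (u.length ::ᵥ binVal u ::ᵥ binVal (d.take (2 * u.length + 3)) ::ᵥ
    answers O u.length (2 ^ u.length * 2 ^ u.length) ::ᵥ .nil)]
  · exact key _ _ (by simpa [Function.update_apply] using hi 2 (by omega))
  · intro t
    fin_cases t
    · simp
    · change _ = un (binVal u)
      simp
    · change _ = un (binVal (d.take (2 * u.length + 3)))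
      simp [i1]
    · change _ = un (answers O u.length (2 ^ u.length * 2 ^ u.length))
      simp
  · intro r hr
    simp only [Function.update_apply]
    split_ifs <;> first | omega | exact hi r (by omega)

end LoopProg

/-- Every primitive recursive function of the input, the beginning of the data and the answers to
all queries on words of the length of the input is computed by a machine, in a time that is bounded
by a computable function of the length of the input. -/
theorem exists_machine {F : ℕ → ℕ → ℕ → ℕ → ℕ}
    (hF : Primrec fun v : List.Vector ℕ 4 => F (v.get 0) (v.get 1) (v.get 2) (v.get 3)) :
    ∃ (M : Machine) (t : ℕ → ℕ), Computable t ∧ ∀ (O : Oracle) (u d : List Bool),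
      ∃ k ≤ t u.length, Outputs O (M.code ++ d) u k (outOf (F u.length (binVal u)
        (binVal (d.take (2 * u.length + 3)))
        (answers O u.length (2 ^ u.length * 2 ^ u.length)))) := by
  obtain ⟨P, hP, he⟩ := LoopProg.exists_evaluator hF
  refine ⟨P.toMachine, P.bound, P.primrec_bound.to_comp, fun O u d => ?_⟩
  obtain ⟨⟨k, hk, hr⟩, -⟩ := P.runs O hP (σ := initStore u d) (s := u.length) (by
    intro r hr
    simp only [initStore]
    split_ifs <;> simp)
  exact ⟨k, hk, P.toMachine, d, _, rfl, hr, he O u d⟩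

/-! ### Binary digits -/

theorem binVal_concat (l : List Bool) (b : Bool) :
    binVal (l ++ [b]) = 2 * binVal l + b.toNat := by
  simp [binVal]

theorem binVal_append (l l' : List Bool) :
    binVal (l ++ l') = binVal l * 2 ^ l'.length + binVal l' := by
  induction l' using List.reverseRecOn with
  | nil => simp [binVal]
  | append_singleton l' b ih =>
    rw [← List.append_assoc, binVal_concat, ih, binVal_concat, List.length_append,
      List.length_singleton]
    ring

theorem binVal_cons (b : Bool) (l : List Bool) :
    binVal (b :: l) = b.toNat * 2 ^ l.length + binVal l := by
  rw [← List.singleton_append, binVal_append]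
  simp [binVal]

theorem binVal_lt (l : List Bool) : binVal l < 2 ^ l.length := by
  induction l with
  | nil => simp [binVal]
  | cons b l ih =>
    rw [binVal_cons, List.length_cons, pow_succ]
    cases b <;> simp <;> omega

theorem testBit_binVal (l : List Bool) (i : ℕ) :
    (binVal l).testBit i = l.reverse.getD i false := by
  induction l using List.reverseRecOn generalizing i with
  | nil => simp [binVal]
  | append_singleton l b ih =>
    rw [binVal_concat]
    cases i with
    | zero => cases b <;> simp [Nat.testBit_zero]
    | succ i =>
      rw [Nat.testBit_succ]
      have : (2 * binVal l + b.toNat) / 2 = binVal l := by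
        cases b
        · simp
        · simp; omega
      rw [this, ih]
      simp

/-- Sequences are indexed from the left and binary digits from the right; hence the subtractions in
`InLeft` and `InRight`. -/
theorem testBit_binVal_sub {l : List Bool} {p : ℕ} (hp : p < l.length) :
    (binVal l).testBit (l.length - 1 - p) = l[p] := by
  rw [testBit_binVal, List.getD_eq_getElem _ _ (by simp; omega), List.getElem_reverse]
  congr 1
  omega

theorem length_digits (b : ℕ → Bool) (k : ℕ) : (digits b k).length = k := by
  induction k with
  | zero => rfl
  | succ k ih => simp [digits, ih]

theorem digits_congr {b b' : ℕ → Bool} {k : ℕ} (h : ∀ i < k, b i = b' i) :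
    digits b k = digits b' k := by
  induction k with
  | zero => rfl
  | succ k ih => simp [digits, h k (by omega), ih fun i hi => h i (by omega)]

theorem digits_testBit_binVal (l : List Bool) :
    digits (binVal l).testBit l.length = l := by
  induction l with
  | nil => rfl
  | cons b l ih =>
    rw [List.length_cons, digits, testBit_binVal]
    congr 1
    · rw [List.getD_eq_getElem _ _ (by simp)]
      simp
    · refine (digits_congr fun i hi => ?_).trans ih
      rw [testBit_binVal, testBit_binVal, List.getD_eq_getElem _ _ (by simp; omega),
        List.getD_eq_getElem _ _ (by simpa using hi)]
      simp [hi]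

theorem binVal_digits {k e : ℕ} (h : e < 2 ^ k) : binVal (digits e.testBit k) = e := by
  apply Nat.eq_of_testBit_eq
  intro i
  have hr : ∀ (b : ℕ → Bool) (k : ℕ), (digits b k).reverse = (List.range k).map b := by
    intro b k
    induction k with
    | zero => rfl
    | succ k ih => simp [digits, ih, List.range_succ]
  rw [testBit_binVal, hr]
  by_cases hi : i < k
  · rw [List.getD_eq_getElem _ _ (by simpa using hi)]
    simp
  · rw [List.getD_eq_default _ _ (by simpa using hi),
      Nat.testBit_lt_two_pow (h.trans_le (Nat.pow_le_pow_right (by omega) (by omega)))]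

/-- At equal length the numerical order is the lexicographic one, so a search for the least code
finds the first minimum cover. -/
theorem le_of_binVal_le {l l' : List Bool} (hl : l.length = l'.length)
    (h : binVal l ≤ binVal l') : l ≤ l' := by
  induction l generalizing l' with
  | nil =>
    cases l' with
    | nil => exact le_rfl
    | cons b' l' => simp at hl
  | cons b l ih =>
    cases l' with
    | nil => simp at hl
    | cons b' l' =>
      simp only [List.length_cons, add_left_inj] at hl
      rw [binVal_cons, binVal_cons, hl] at h
      have h₁ := binVal_lt l
      have h₂ := binVal_lt l'
      rw [hl] at h₁
      cases b <;> cases b' <;> simp at h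
      · exact List.cons_le_cons _ (ih hl h)
      · exact le_of_lt (List.Lex.rel (by decide))
      · omega
      · exact List.cons_le_cons _ (ih hl h)

/-! ### Words -/

/-- The position of a word in the lexicographic order. -/
def wordNum {n : ℕ} (x : Word n) : ℕ := binVal x.toList

theorem wordNum_lt {n : ℕ} (x : Word n) : wordNum x < 2 ^ n := by
  simpa [wordNum] using binVal_lt x.toList

theorem length_allWords (n : ℕ) : (allWords n).length = 2 ^ n := by
  induction n with
  | zero => rfl
  | succ n ih => simp [allWords, ih, pow_succ]; ring

theorem getElem?_allWords {n : ℕ} (x : Word n) : (allWords n)[wordNum x]? = some x := by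
  induction n with
  | zero =>
    obtain rfl : x = .nil := Subsingleton.elim _ _
    rfl
  | succ n ih =>
    obtain ⟨b, x, rfl⟩ := List.Vector.exists_eq_cons x
    have hl := wordNum_lt x
    have hv : wordNum (b ::ᵥ x) = b.toNat * 2 ^ n + wordNum x := by
      simp [wordNum, binVal_cons]
    rw [hv, allWords]
    cases b
    · rw [List.getElem?_append_left (by simpa [length_allWords] using hl)]
      simp [ih]
    · rw [List.getElem?_append_right (by simp [length_allWords])]
      simp [length_allWords, ih]

theorem wordNum_getElem {n k : ℕ} (hk : k < (allWords n).length) :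
    wordNum (allWords n)[k] = k := by
  have hk' : k < 2 ^ n := by rwa [length_allWords] at hk
  let x : Word n := ⟨digits k.testBit n, length_digits _ _⟩
  have hx : wordNum x = k := binVal_digits hk'
  have := getElem?_allWords x
  rw [hx, List.getElem?_eq_getElem hk] at this
  rw [Option.some.inj this, hx]

theorem exists_wordNum_eq {n k : ℕ} (hk : k < 2 ^ n) : ∃ x : Word n, wordNum x = k :=
  ⟨_, wordNum_getElem (by rwa [length_allWords])⟩

theorem nodup_allWords (n : ℕ) : (allWords n).Nodup := by
  rw [List.nodup_iff_injective_get]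
  intro i j h
  have hi := wordNum_getElem i.2
  have hj := wordNum_getElem j.2
  simp only [List.get_eq_getElem] at h
  rw [h, hj] at hi
  exact Fin.ext hi.symm

theorem digits_wordNum {n : ℕ} (x : Word n) : digits (wordNum x).testBit n = x.toList := by
  have := digits_testBit_binVal x.toList
  rwa [List.Vector.toList_length] at this

theorem answers_lt (O : Oracle) (n k : ℕ) : answers O n k < 2 ^ k := by
  induction k with
  | zero => simp [answers]
  | succ k ih =>
    rw [answers, pow_succ]
    split_ifs <;> omega

/-- Step i adds 0 or 2^i to a number below 2^i, so it decides bit i and leaves the lower bits alone.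
-/
theorem testBit_answers (O : Oracle) (n : ℕ) {i k : ℕ} (hi : i < k) :
    (answers O n k).testBit i =
      O (digits (i / 2 ^ n).testBit n) (digits (i % 2 ^ n).testBit n) := by
  induction k with
  | zero => omega
  | succ k ih =>
    have hlt := answers_lt O n k
    rw [answers]
    rcases Nat.lt_succ_iff_lt_or_eq.1 hi with h | rfl
    · rw [← ih h]
      split_ifs
      · rw [add_comm, Nat.testBit_two_pow_add_gt h]
      · rfl
    · split_ifs with h
      · rw [add_comm, Nat.testBit_two_pow_add_eq, Nat.testBit_lt_two_pow hlt, h]; rfl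
      · rw [Nat.add_zero, Nat.testBit_lt_two_pow hlt]; simpa using h

/-- The values of `f` on the words of length `n`, as a number. -/
def valueTable (f : Family) (n : ℕ) : ℕ := answers f.oracle n (2 ^ n * 2 ^ n)

theorem testBit_valueTable (f : Family) {n : ℕ} (x y : Word n) :
    (valueTable f n).testBit (wordNum x * 2 ^ n + wordNum y) = f n x y := by
  have hx := wordNum_lt x
  have hy := wordNum_lt y
  have hlt : wordNum x * 2 ^ n + wordNum y < 2 ^ n * 2 ^ n :=
    calc _ < (wordNum x + 1) * 2 ^ n := by rw [add_mul, one_mul]; omega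
      _ ≤ _ := Nat.mul_le_mul_right _ hx
  have e₁ : (wordNum x * 2 ^ n + wordNum y) / 2 ^ n = wordNum x := by
    rw [mul_comm, Nat.mul_add_div (by positivity), Nat.div_eq_of_lt hy, add_zero]
  have e₂ : (wordNum x * 2 ^ n + wordNum y) % 2 ^ n = wordNum y := by
    rw [mul_comm, Nat.mul_add_mod, Nat.mod_eq_of_lt hy]
  rw [valueTable, testBit_answers _ _ hlt, e₁, e₂, digits_wordNum, digits_wordNum]
  obtain ⟨x, rfl⟩ := x
  obtain ⟨y, hl⟩ := y
  exact dif_pos hl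

/-! ### Covers -/

theorem length_setBits {n : ℕ} (A : Finset (Word n)) : (setBits A).length = 2 ^ n := by
  simp [setBits, length_allWords]

theorem coverBits_cons {n : ℕ} (R : Rect n) (s : List (Rect n)) :
    coverBits (R :: s) = setBits R.1 ++ (setBits R.2 ++ coverBits s) := by
  simp [coverBits]

theorem length_coverBits {n : ℕ} (s : List (Rect n)) :
    (coverBits s).length = s.length * (2 * 2 ^ n) := by
  induction s with
  | nil => simp [coverBits]
  | cons R s ih => rw [coverBits_cons]; simp [length_setBits, ih]; ring

theorem getElem?_setBits {n : ℕ} (A : Finset (Word n)) (x : Word n) :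
    (setBits A)[wordNum x]? = some (decide (x ∈ A)) := by
  simp [setBits, getElem?_allWords]

/-- Each rectangle occupies a block of 2 · 2^n bits, its first side in the first half. -/
theorem getElem?_coverBits {n : ℕ} {s : List (Rect n)} {j : ℕ} (hj : j < s.length) (x : Word n) :
    (coverBits s)[j * (2 * 2 ^ n) + wordNum x]? = some (decide (x ∈ s[j].1)) ∧
    (coverBits s)[j * (2 * 2 ^ n) + (2 ^ n + wordNum x)]? = some (decide (x ∈ s[j].2)) := by
  have hx := wordNum_lt x
  induction s generalizing j with
  | nil => simp at hj
  | cons R s ih =>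
    rw [coverBits_cons]
    cases j with
    | zero =>
      rw [zero_mul, zero_add, zero_add]
      constructor
      · rw [List.getElem?_append_left (by rwa [length_setBits]), getElem?_setBits]; rfl
      · rw [List.getElem?_append_right (by rw [length_setBits]; omega), length_setBits,
          List.getElem?_append_left (by rw [length_setBits]; omega), Nat.add_sub_cancel_left,
          getElem?_setBits]; rfl
    | succ j =>
      have h := ih (j := j) (by simpa using hj)
      have e : (j + 1) * (2 * 2 ^ n) = 2 ^ n + (2 ^ n + j * (2 * 2 ^ n)) := by ring
      rw [e]
      simp only [add_assoc]
      rw [List.getElem?_append_right (by rw [length_setBits]; omega), length_setBits,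
        List.getElem?_append_right (by rw [length_setBits]; omega), length_setBits,
        List.getElem?_append_right (by rw [length_setBits]; omega), length_setBits,
        List.getElem?_append_right (by rw [length_setBits]; omega), length_setBits]
      simp only [Nat.add_sub_cancel_left]
      exact h

theorem exists_map_mem_eq {α : Type*} [DecidableEq α] {ws : List α} (hws : ws.Nodup)
    {l : List Bool} (hl : l.length = ws.length) :
    ∃ A : Finset α, (∀ x ∈ A, x ∈ ws) ∧ ws.map (fun x => decide (x ∈ A)) = l := by
  induction ws generalizing l with
  | nil => exact ⟨∅, by simp, by simpa using (List.length_eq_zero_iff.1 hl).symm⟩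
  | cons w ws ih =>
    cases l with
    | nil => simp at hl
    | cons b l =>
      obtain ⟨hw, hws⟩ := List.nodup_cons.1 hws
      obtain ⟨A, hA, he⟩ := ih hws (by simpa using hl)
      have hwA : w ∉ A := fun h => hw (hA w h)
      cases b
      · exact ⟨A, fun x hx => List.mem_cons_of_mem _ (hA x hx), by simp [hwA, he]⟩
      · refine ⟨insert w A, fun x hx => ?_, ?_⟩
        · rcases Finset.mem_insert.1 hx with rfl | h
          · exact List.mem_cons_self
          · exact List.mem_cons_of_mem _ (hA x h)
        · rw [List.map_cons, ← he]
          congr 1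
          · simp
          · refine List.map_congr_left fun x hx => ?_
            have : x ≠ w := by rintro rfl; exact hw hx
            simp [this]

theorem exists_setBits_eq {n : ℕ} {l : List Bool} (hl : l.length = 2 ^ n) :
    ∃ A : Finset (Word n), setBits A = l := by
  obtain ⟨A, -, h⟩ := exists_map_mem_eq (nodup_allWords n) (hl.trans (length_allWords n).symm)
  exact ⟨A, h⟩

/-- Guarantees that a number found by the search is the code of an actual sequence of rectangles. -/
theorem exists_coverBits_eq {n m : ℕ} {l : List Bool} (hl : l.length = m * (2 * 2 ^ n)) :
    ∃ s : List (Rect n), s.length = m ∧ coverBits s = l := by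
  induction m generalizing l with
  | zero => exact ⟨[], rfl, by simpa [coverBits] using hl⟩
  | succ m ih =>
    have e : (m + 1) * (2 * 2 ^ n) = 2 ^ n + (2 ^ n + m * (2 * 2 ^ n)) := by ring
    rw [e] at hl
    obtain ⟨A, hA⟩ := exists_setBits_eq (n := n) (l := l.take (2 ^ n)) (by simp [hl])
    obtain ⟨B, hB⟩ := exists_setBits_eq (n := n) (l := (l.drop (2 ^ n)).take (2 ^ n)) (by simp [hl])
    obtain ⟨s, hs, h⟩ := ih (l := (l.drop (2 ^ n)).drop (2 ^ n)) (by simp [hl]; omega)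
    exact ⟨(A, B) :: s, by simp [hs], by
      rw [coverBits_cons, hA, hB, h, List.take_append_drop, List.take_append_drop]⟩

/-- Membership of the word with number `x` in the first side of the rectangle number `j` of the
sequence of `m` rectangles with code `e`. -/
def InLeft (n m e j x : ℕ) : Prop :=
  e.testBit (m * (2 * 2 ^ n) - 1 - (j * (2 * 2 ^ n) + x)) = true

/-- Membership of the word with number `y` in the second side of the rectangle number `j` of the
sequence of `m` rectangles with code `e`. -/
def InRight (n m e j y : ℕ) : Prop :=
  e.testBit (m * (2 * 2 ^ n) - 1 - (j * (2 * 2 ^ n) + (2 ^ n + y))) = true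

theorem inLeft_coverBits {n : ℕ} {s : List (Rect n)} {j : ℕ} (hj : j < s.length) (x : Word n) :
    InLeft n s.length (binVal (coverBits s)) j (wordNum x) ↔ x ∈ s[j].1 := by
  have h := (getElem?_coverBits hj x).1
  obtain ⟨hlt, h⟩ := List.getElem?_eq_some_iff.1 h
  rw [InLeft, ← length_coverBits, testBit_binVal_sub hlt, h, decide_eq_true_iff]

theorem inRight_coverBits {n : ℕ} {s : List (Rect n)} {j : ℕ} (hj : j < s.length) (x : Word n) :
    InRight n s.length (binVal (coverBits s)) j (wordNum x) ↔ x ∈ s[j].2 := by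
  have h := (getElem?_coverBits hj x).2
  obtain ⟨hlt, h⟩ := List.getElem?_eq_some_iff.1 h
  rw [InRight, ← length_coverBits, testBit_binVal_sub hlt, h, decide_eq_true_iff]

/-- The sequence of `m` rectangles with code `e` is a `z`-cover of the function with values `T`. -/
def CodesCover (n T : ℕ) (z : Bool) (m e : ℕ) : Prop :=
  ∀ x < 2 ^ n, ∀ y < 2 ^ n,
    ((∃ j < m, InLeft n m e j x ∧ InRight n m e j y) ↔ T.testBit (x * 2 ^ n + y) = z)

/-- The two directions of the equivalence inside `CodesCover` are the two halves of `IsCover`, with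
words replaced by their numbers. -/
theorem codesCover_iff (f : Family) {n : ℕ} (z : Bool) (s : List (Rect n)) :
    CodesCover n (valueTable f n) z s.length (binVal (coverBits s)) ↔ IsCover (f n) z s := by
  have key : ∀ x y : Word n, (∃ j < s.length, InLeft n s.length (binVal (coverBits s)) j (wordNum x)
      ∧ InRight n s.length (binVal (coverBits s)) j (wordNum y)) ↔ ∃ R ∈ s, R.Contains x y := by
    intro x y
    constructor
    · rintro ⟨j, hj, h₁, h₂⟩
      exact ⟨s[j], List.getElem_mem hj, (inLeft_coverBits hj x).1 h₁, (inRight_coverBits hj y).1 h₂⟩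
    · rintro ⟨R, hR, h₁, h₂⟩
      obtain ⟨j, hj, rfl⟩ := List.getElem_of_mem hR
      exact ⟨j, hj, (inLeft_coverBits hj x).2 h₁, (inRight_coverBits hj y).2 h₂⟩
  constructor
  · intro h
    have h' : ∀ x y : Word n, (∃ R ∈ s, R.Contains x y) ↔ f n x y = z := fun x y => by
      rw [← key, h _ (wordNum_lt x) _ (wordNum_lt y), testBit_valueTable]
    exact ⟨fun R hR x y hc => (h' x y).1 ⟨R, hR, hc⟩, fun x y hf => (h' x y).2 hf⟩
  · rintro ⟨h₁, h₂⟩ x hx y hy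
    obtain ⟨x, rfl⟩ := exists_wordNum_eq hx
    obtain ⟨y, rfl⟩ := exists_wordNum_eq hy
    rw [key, testBit_valueTable]
    exact ⟨fun ⟨R, hR, hc⟩ => h₁ R hR x y hc, h₂ x y⟩

/-- The first minimum cover has `m` rectangles and the code `e`. -/
def CodesFirst (n T : ℕ) (z : Bool) (m e : ℕ) : Prop :=
  e < 2 ^ (m * (2 * 2 ^ n)) ∧ CodesCover n T z m e ∧
  (∀ m' < m, ∀ e' < 2 ^ (m' * (2 * 2 ^ n)), ¬ CodesCover n T z m' e') ∧
  ∀ e' < e, ¬ CodesCover n T z m e'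

/-- Used to identify whatever the search finds with the covers fixed in the proof. -/
theorem CodesFirst.unique {n T : ℕ} {z : Bool} {m e m' e' : ℕ} (h : CodesFirst n T z m e)
    (h' : CodesFirst n T z m' e') : m = m' ∧ e = e' := by
  obtain ⟨h₁, h₂, h₃, h₄⟩ := h
  obtain ⟨h₁', h₂', h₃', h₄'⟩ := h'
  obtain rfl : m = m' := by
    rcases lt_trichotomy m m' with h | h | h
    · exact absurd h₂ (h₃' m h e h₁)
    · exact h
    · exact absurd h₂' (h₃ m' h e' h₁')
  refine ⟨rfl, ?_⟩
  rcases lt_trichotomy e e' with h | h | h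
  · exact absurd h₂ (h₄' e h)
  · exact h
  · exact absurd h₂' (h₄ e' h)

theorem binVal_coverBits_lt {n : ℕ} (s : List (Rect n)) :
    binVal (coverBits s) < 2 ^ (s.length * (2 * 2 ^ n)) := by
  rw [← length_coverBits]; exact binVal_lt _

theorem CodesFirst.isFirstMinCover {f : Family} {n : ℕ} {z : Bool} {s : List (Rect n)}
    (h : CodesFirst n (valueTable f n) z s.length (binVal (coverBits s))) :
    IsFirstMinCover (f n) z s := by
  obtain ⟨-, h₂, h₃, h₄⟩ := h
  have hmin : IsMinCover (f n) z s := by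
    refine ⟨(codesCover_iff f z s).1 h₂, fun s' hs' => ?_⟩
    by_contra hlt
    exact h₃ _ (not_le.1 hlt) _ (binVal_coverBits_lt s') ((codesCover_iff f z s').2 hs')
  refine ⟨hmin, fun s' hs' => ?_⟩
  have hl : s.length = s'.length := le_antisymm (hmin.2 s' hs'.1) (hs'.2 s hmin.1)
  apply le_of_binVal_le
  · rw [length_coverBits, length_coverBits, hl]
  · by_contra hlt
    refine h₄ _ (not_le.1 hlt) ?_
    rw [hl]
    exact (codesCover_iff f z s').2 hs'.1

/-- The cover by single inputs. -/
theorem exists_isCover {n : ℕ} (g : Word n → Word n → Bool) (z : Bool) :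
    ∃ s : List (Rect n), IsCover g z s ∧ s.length ≤ 2 ^ n * 2 ^ n := by
  classical
  refine ⟨((Finset.univ : Finset (Word n × Word n)).filter fun q => g q.1 q.2 = z).toList.map
    fun q => ({q.1}, {q.2}), ⟨?_, ?_⟩, ?_⟩
  · intro R hR x y hc
    obtain ⟨q, hq, rfl⟩ := List.mem_map.1 hR
    obtain ⟨h₁, h₂⟩ := hc
    simp only [Finset.mem_singleton] at h₁ h₂
    subst h₁ h₂
    simpa using hq
  · intro x y h
    exact ⟨({x}, {y}), List.mem_map.2 ⟨(x, y), by simpa using h, rfl⟩, by simp [Rect.Contains]⟩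
  · rw [List.length_map, Finset.length_toList]
    refine (Finset.card_filter_le _ _).trans ?_
    simp [card_vector]

/-- Minimize first the length and then the code. The cover by single inputs bounds the length, which
makes the search bounded. -/
theorem exists_codesFirst (f : Family) (n : ℕ) (z : Bool) : ∃ s : List (Rect n),
    CodesFirst n (valueTable f n) z s.length (binVal (coverBits s)) ∧
      s.length ≤ 2 ^ n * 2 ^ n := by
  classical
  obtain ⟨s, hs, hle⟩ := exists_isCover (f n) z
  have h : ∃ m e, e < 2 ^ (m * (2 * 2 ^ n)) ∧ CodesCover n (valueTable f n) z m e :=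
    ⟨s.length, _, binVal_coverBits_lt s, (codesCover_iff f z s).2 hs⟩
  have hm := Nat.find_spec h
  obtain ⟨he₁, he₂⟩ := Nat.find_spec hm
  obtain ⟨s', hl', hs'⟩ := exists_coverBits_eq (n := n) (m := Nat.find h)
    (l := digits (Nat.find hm).testBit (Nat.find h * (2 * 2 ^ n))) (length_digits _ _)
  refine ⟨s', ?_, ?_⟩
  · rw [hl', hs', binVal_digits he₁]
    exact ⟨he₁, he₂, fun m' hm' e' he' hc => Nat.find_min h hm' ⟨e', he', hc⟩,
      fun e' he' hc => Nat.find_min hm he' ⟨he'.trans he₁, hc⟩⟩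
  · rw [hl']
    exact (Nat.find_min' h ⟨_, binVal_coverBits_lt s, (codesCover_iff f z s).2 hs⟩).trans hle

/-! ### The search for the first minimum covers is primitive recursive -/

section Primrec

variable {α : Type*} [Primcodable α]

theorem primrecPred_exists_lt {b : α → ℕ} {p : α → ℕ → Prop} (hb : Primrec b)
    (hp : PrimrecPred fun q : α × ℕ => p q.1 q.2) : PrimrecPred fun a => ∃ x < b a, p a x := by
  have h : PrimrecRel fun (x : ℕ) (a : α) => p a x :=
    hp.comp (Primrec.pair Primrec.snd Primrec.fst)
  exact (h.exists_mem_list.comp (Primrec.list_range.comp hb) Primrec.id).of_eq (by simp)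

theorem primrecPred_forall_lt {b : α → ℕ} {p : α → ℕ → Prop} (hb : Primrec b)
    (hp : PrimrecPred fun q : α × ℕ => p q.1 q.2) : PrimrecPred fun a => ∀ x < b a, p a x :=
  (primrecPred_exists_lt (p := fun a x => ¬ p a x) hb hp.not).not.of_eq (by simp)

theorem primrecPred_iff {p q : α → Prop} (hp : PrimrecPred p) (hq : PrimrecPred q) :
    PrimrecPred fun a => (p a ↔ q a) :=
  ((hp.and hq).or (hp.not.and hq.not)).of_eq fun _ => iff_iff_and_or_not_and_not.symm

theorem primrec_testBit : Primrec₂ Nat.testBit := by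
  have h : PrimrecPred fun q : ℕ × ℕ => q.1 / 2 ^ q.2 % 2 = 1 :=
    Primrec.eq.comp (Primrec.nat_mod.comp (Primrec.nat_div.comp Primrec.fst
      (primrec_two_pow.comp Primrec.snd)) (Primrec.const 2)) (Primrec.const 1)
  exact h.decide.of_eq fun q => (Nat.testBit_eq_decide_div_mod_eq).symm

variable {n T m e j x D Y : α → ℕ}

theorem primrec_two_pow_comp (hn : Primrec n) : Primrec fun a => 2 ^ n a :=
  primrec_two_pow.comp hn

theorem primrec_rows (hn : Primrec n) (hm : Primrec m) : Primrec fun a => m a * (2 * 2 ^ n a) :=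
  Primrec.nat_mul.comp hm (Primrec.nat_double.comp (primrec_two_pow_comp hn))

theorem primrecPred_inLeft (hn : Primrec n) (hm : Primrec m) (he : Primrec e) (hj : Primrec j)
    (hx : Primrec x) : PrimrecPred fun a => InLeft (n a) (m a) (e a) (j a) (x a) :=
  Primrec.eq.comp (primrec_testBit.comp he (Primrec.nat_sub.comp
    (Primrec.nat_sub.comp (primrec_rows hn hm) (Primrec.const 1))
    (Primrec.nat_add.comp (primrec_rows hn hj) hx))) (Primrec.const true)

theorem primrecPred_inRight (hn : Primrec n) (hm : Primrec m) (he : Primrec e) (hj : Primrec j)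
    (hx : Primrec x) : PrimrecPred fun a => InRight (n a) (m a) (e a) (j a) (x a) :=
  Primrec.eq.comp (primrec_testBit.comp he (Primrec.nat_sub.comp
    (Primrec.nat_sub.comp (primrec_rows hn hm) (Primrec.const 1))
    (Primrec.nat_add.comp (primrec_rows hn hj)
      (Primrec.nat_add.comp (primrec_two_pow_comp hn) hx)))) (Primrec.const true)

theorem primrecPred_codesCover (hn : Primrec n) (hT : Primrec T) (z : Bool) (hm : Primrec m)
    (he : Primrec e) : PrimrecPred fun a => CodesCover (n a) (T a) z (m a) (e a) := by
  refine primrecPred_forall_lt (primrec_two_pow_comp hn) (primrecPred_forall_lt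
    (primrec_two_pow_comp (hn.comp Primrec.fst)) (primrecPred_iff (primrecPred_exists_lt
      (hm.comp (Primrec.fst.comp Primrec.fst)) (.and ?_ ?_)) ?_))
  · have f : Primrec fun q : ((α × ℕ) × ℕ) × ℕ => q.1.1.1 :=
      Primrec.fst.comp (Primrec.fst.comp Primrec.fst)
    exact primrecPred_inLeft (hn.comp f) (hm.comp f) (he.comp f) Primrec.snd
      (Primrec.snd.comp (Primrec.fst.comp Primrec.fst))
  · have f : Primrec fun q : ((α × ℕ) × ℕ) × ℕ => q.1.1.1 :=
      Primrec.fst.comp (Primrec.fst.comp Primrec.fst)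
    exact primrecPred_inRight (hn.comp f) (hm.comp f) (he.comp f) Primrec.snd
      (Primrec.snd.comp Primrec.fst)
  · have f : Primrec fun q : (α × ℕ) × ℕ => q.1.1 := Primrec.fst.comp Primrec.fst
    exact Primrec.eq.comp (primrec_testBit.comp (hT.comp f) (Primrec.nat_add.comp
      (Primrec.nat_mul.comp (Primrec.snd.comp Primrec.fst) (primrec_two_pow_comp (hn.comp f)))
      Primrec.snd)) (Primrec.const z)

theorem primrecPred_codesFirst (hn : Primrec n) (hT : Primrec T) (z : Bool) (hm : Primrec m)
    (he : Primrec e) : PrimrecPred fun a => CodesFirst (n a) (T a) z (m a) (e a) := by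
  have f : Primrec fun q : α × ℕ => q.1 := Primrec.fst
  have f' : Primrec fun q : (α × ℕ) × ℕ => q.1.1 := Primrec.fst.comp Primrec.fst
  refine .and (Primrec.nat_lt.comp he (primrec_two_pow_comp (primrec_rows hn hm)))
    (.and (primrecPred_codesCover hn hT z hm he) (.and ?_ ?_))
  · exact primrecPred_forall_lt hm (primrecPred_forall_lt
      (primrec_two_pow_comp (primrec_rows (hn.comp f) Primrec.snd))
      (primrecPred_codesCover (hn.comp f') (hT.comp f') z (Primrec.snd.comp Primrec.fst)
        Primrec.snd).not)
  · exact primrecPred_forall_lt he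
      (primrecPred_codesCover (hn.comp f) (hT.comp f) z (hm.comp f) Primrec.snd).not

/-- The word with number `Y` is in the second side of the rectangle number `D` of the first
minimum `0`-cover. -/
def InFirstZero (n Y D T : ℕ) : Prop :=
  ∃ m < 2 ^ n * 2 ^ n + 1, ∃ e < 2 ^ (m * (2 * 2 ^ n)),
    CodesFirst n T false m e ∧ D < m ∧ InRight n m e D Y

/-- The word with number `Y` is in the second side of the rectangle number `D - m` of the first
minimum `1`-cover, where `m` is the length of the first minimum `0`-cover. -/
def InFirstOne (n Y D T : ℕ) : Prop :=
  ∃ m < 2 ^ n * 2 ^ n + 1, ∃ e < 2 ^ (m * (2 * 2 ^ n)),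
    CodesFirst n T false m e ∧ m ≤ D ∧
      ∃ m' < 2 ^ n * 2 ^ n + 1, ∃ e' < 2 ^ (m' * (2 * 2 ^ n)),
        CodesFirst n T true m' e' ∧ InRight n m' e' (D - m) Y

open Classical in
/-- The answer, as a number, on the word with number `Y` of the program built from the rectangle
number `D` of the first minimum covers. -/
noncomputable def coverAnswer (n Y D T : ℕ) : ℕ :=
  if InFirstOne n Y D T then 2 else if InFirstZero n Y D T then 1 else 0

theorem primrec_square (hn : Primrec n) : Primrec fun a => 2 ^ n a * 2 ^ n a + 1 :=
  Primrec.succ.comp (Primrec.nat_mul.comp (primrec_two_pow_comp hn) (primrec_two_pow_comp hn))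

theorem primrecPred_inFirstZero (hn : Primrec n) (hY : Primrec Y) (hD : Primrec D)
    (hT : Primrec T) : PrimrecPred fun a => InFirstZero (n a) (Y a) (D a) (T a) := by
  have f : Primrec fun q : α × ℕ => q.1 := Primrec.fst
  have f' : Primrec fun q : (α × ℕ) × ℕ => q.1.1 := Primrec.fst.comp Primrec.fst
  have m : Primrec fun q : (α × ℕ) × ℕ => q.1.2 := Primrec.snd.comp Primrec.fst
  exact primrecPred_exists_lt (primrec_square hn) (primrecPred_exists_lt
    (primrec_two_pow_comp (primrec_rows (hn.comp f) Primrec.snd))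
    (.and (primrecPred_codesFirst (hn.comp f') (hT.comp f') false m Primrec.snd)
      (.and (Primrec.nat_lt.comp (hD.comp f') m)
        (primrecPred_inRight (hn.comp f') m Primrec.snd (hD.comp f') (hY.comp f')))))

theorem primrecPred_inFirstOne (hn : Primrec n) (hY : Primrec Y) (hD : Primrec D)
    (hT : Primrec T) : PrimrecPred fun a => InFirstOne (n a) (Y a) (D a) (T a) := by
  have f : Primrec fun q : α × ℕ => q.1 := Primrec.fst
  have f₂ : Primrec fun q : (α × ℕ) × ℕ => q.1.1 := Primrec.fst.comp Primrec.fst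
  have f₃ : Primrec fun q : ((α × ℕ) × ℕ) × ℕ => q.1.1.1 := f₂.comp Primrec.fst
  have f₄ : Primrec fun q : (((α × ℕ) × ℕ) × ℕ) × ℕ => q.1.1.1.1 := f₃.comp Primrec.fst
  have m₂ : Primrec fun q : (α × ℕ) × ℕ => q.1.2 := Primrec.snd.comp Primrec.fst
  have m₄ : Primrec fun q : (((α × ℕ) × ℕ) × ℕ) × ℕ => q.1.1.1.2 :=
    m₂.comp (Primrec.fst.comp Primrec.fst)
  have m' : Primrec fun q : (((α × ℕ) × ℕ) × ℕ) × ℕ => q.1.2 := Primrec.snd.comp Primrec.fst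
  exact primrecPred_exists_lt (primrec_square hn) (primrecPred_exists_lt
    (primrec_two_pow_comp (primrec_rows (hn.comp f) Primrec.snd))
    (.and (primrecPred_codesFirst (hn.comp f₂) (hT.comp f₂) false m₂ Primrec.snd)
      (.and (Primrec.nat_le.comp m₂ (hD.comp f₂))
        (primrecPred_exists_lt (primrec_square (hn.comp f₂)) (primrecPred_exists_lt
          (primrec_two_pow_comp (primrec_rows (hn.comp f₃) Primrec.snd))
          (.and (primrecPred_codesFirst (hn.comp f₄) (hT.comp f₄) true m' Primrec.snd)
            (primrecPred_inRight (hn.comp f₄) m' Primrec.snd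
              (Primrec.nat_sub.comp (hD.comp f₄) m₄) (hY.comp f₄))))))))

theorem primrec_coverAnswer (hn : Primrec n) (hY : Primrec Y) (hD : Primrec D) (hT : Primrec T) :
    Primrec fun a => coverAnswer (n a) (Y a) (D a) (T a) := by
  classical
  exact (Primrec.ite (primrecPred_inFirstOne hn hY hD hT) (Primrec.const 2)
    (Primrec.ite (primrecPred_inFirstZero hn hY hD hT) (Primrec.const 1)
      (Primrec.const 0))).of_eq fun a => by simp [coverAnswer]

end Primrec

/-- The length bounds place both covers inside the search range, and `CodesFirst.unique` excludes
any other result of the search. -/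
theorem outOf_coverAnswer (f : Family) {n : ℕ} {s₀ s₁ : List (Rect n)}
    (h₀ : CodesFirst n (valueTable f n) false s₀.length (binVal (coverBits s₀)))
    (h₁ : CodesFirst n (valueTable f n) true s₁.length (binVal (coverBits s₁)))
    (hl₀ : s₀.length ≤ 2 ^ n * 2 ^ n) (hl₁ : s₁.length ≤ 2 ^ n * 2 ^ n)
    (i : Fin (s₀ ++ s₁).length) (y : Word n) :
    outOf (coverAnswer n (wordNum y) i (valueTable f n)) =
      rectAnswer ((s₀ ++ s₁).get i) (decide (s₀.length ≤ (i : ℕ))) y := by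
  obtain ⟨i, hi⟩ := i
  simp only [List.get_eq_getElem, rectAnswer]
  have hone : InFirstOne n (wordNum y) i (valueTable f n) ↔ s₀.length ≤ i ∧
      InRight n s₁.length (binVal (coverBits s₁)) (i - s₀.length) (wordNum y) := by
    constructor
    · rintro ⟨m, -, e, -, h, hm, m', -, e', -, h', hr⟩
      obtain ⟨rfl, rfl⟩ := h.unique h₀
      obtain ⟨rfl, rfl⟩ := h'.unique h₁
      exact ⟨hm, hr⟩
    · rintro ⟨hm, hr⟩
      exact ⟨_, Nat.lt_succ_of_le hl₀, _, h₀.1, h₀, hm, _, Nat.lt_succ_of_le hl₁, _, h₁.1, h₁, hr⟩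
  have hzero : InFirstZero n (wordNum y) i (valueTable f n) ↔ i < s₀.length ∧
      InRight n s₀.length (binVal (coverBits s₀)) i (wordNum y) := by
    constructor
    · rintro ⟨m, -, e, -, h, hm, hr⟩
      obtain ⟨rfl, rfl⟩ := h.unique h₀
      exact ⟨hm, hr⟩
    · rintro ⟨hm, hr⟩
      exact ⟨_, Nat.lt_succ_of_le hl₀, _, h₀.1, h₀, hm, hr⟩
  by_cases hlt : i < s₀.length
  · have hle : ¬ s₀.length ≤ i := not_le.2 hlt
    rw [List.getElem_append_left hlt]
    have hmem := inRight_coverBits hlt y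
    by_cases hr : y ∈ s₀[i].2
    · simp [coverAnswer, hone, hzero, hle, hlt, hr, hmem, outOf]
    · simp [coverAnswer, hone, hzero, hle, hr, hmem, outOf]
  · have hle : s₀.length ≤ i := not_lt.1 hlt
    have hi' : i - s₀.length < s₁.length := by
      rw [List.length_append] at hi
      omega
    rw [List.getElem_append_right hle]
    have hmem := inRight_coverBits hi' y
    by_cases hr : y ∈ s₁[i - s₀.length].2
    · simp [coverAnswer, hone, hle, hr, hmem, outOf]
    · simp [coverAnswer, hone, hzero, hle, hlt, hr, hmem, outOf]

/-- A machine that, given the number of a rectangle of the first minimum covers, recognizes the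
second side of this rectangle. -/
theorem exists_coverMachine : ∃ (M : Machine) (t : ℕ → ℕ), Computable t ∧
    ∀ (O : Oracle) (u d : List Bool), ∃ k ≤ t u.length, Outputs O (M.code ++ d) u k
      (outOf (coverAnswer u.length (binVal u) (binVal (d.take (2 * u.length + 3)))
        (answers O u.length (2 ^ u.length * 2 ^ u.length)))) := by
  have get (i : Fin 4) : Primrec fun v : List.Vector ℕ 4 => v.get i :=
    Primrec.vector_get.comp Primrec.id (Primrec.const i)
  exact exists_machine (primrec_coverAnswer (get 0) (get 1) (get 2) (get 3))

/-! ### Programs as guesses -/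

/-- The description of the machine is self-delimiting and machines are deterministic. Exhibiting one
run thus settles the conditions of `Corresponds` that concern all runs. -/
theorem Outputs.det {O : Oracle} {p y : List Bool} {k k' : ℕ} {v v' : Option Bool}
    (h : Outputs O p y k v) (h' : Outputs O p y k' v') : v = v' := by
  obtain ⟨M, d, σ, rfl, hr, hv⟩ := h
  obtain ⟨M', d', σ', he, hr', hv'⟩ := h'
  obtain ⟨rfl, rfl⟩ := Machine.code_append_inj he
  obtain ⟨-, rfl⟩ := hr.det hr'
  rw [hv] at hv'
  cases v <;> cases v' <;> simp_all [outputWord]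

/-- Programs of length at most `K` that correspond to all instance complexities yield covers. -/
theorem exists_isCover_of_corresponds {O : Oracle} {t : ℕ → ℕ} {n : ℕ} {g : Word n → Word n → Bool}
    {K : ℕ} (h : ∀ x y, ∃ p : List Bool, p.length ≤ K ∧ Corresponds O t y (Y₁ g x) p) (z : Bool) :
    ∃ s, IsCover g z s ∧ s.length ≤ 2 ^ (K + 1) := by
  classical
  let progs : List (List Bool) := (List.range (K + 1)).flatMap fun k =>
    (Finset.univ : Finset (List.Vector Bool k)).toList.map List.Vector.toList
  have hmem : ∀ p : List Bool, p.length ≤ K → p ∈ progs := fun p hp =>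
    List.mem_flatMap.2 ⟨p.length, List.mem_range.2 (by omega),
      List.mem_map.2 ⟨⟨p, rfl⟩, Finset.mem_toList.2 (Finset.mem_univ _), rfl⟩⟩
  have hlen : progs.length ≤ 2 ^ (K + 1) := by
    have e : progs.length = ((List.range (K + 1)).map fun k => 2 ^ k).sum := by
      simp [progs, List.length_flatMap, card_vector]
    rw [e, ← List.sum_toFinset _ List.nodup_range, List.toFinset_range]
    exact (Nat.geomSum_lt (m := 2) le_rfl (by simp)).le
  -- Consistency with Y₁(x) depends on x and p only, and the answer of p on y and p only; hence a
  -- rectangle for each p. Consistency makes it monochromatic.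
  refine ⟨progs.map fun p => (Finset.univ.filter fun x => TotalWithin O t p ∧
    Consistent O p (Y₁ g x), Finset.univ.filter fun y : Word n => ∃ k, Outputs O p y.toList k
      (some z)), ⟨?_, ?_⟩, by simpa using hlen⟩
  · intro R hR x y hc
    obtain ⟨p, -, rfl⟩ := List.mem_map.1 hR
    simp only [Rect.Contains, Finset.mem_filter, Finset.mem_univ, true_and] at hc
    obtain ⟨⟨-, hcons⟩, hy⟩ := hc
    cases z
    · simpa [Y₁] using (hcons y).2 hy
    · exact (hcons y).1 hy
  · intro x y hxy
    obtain ⟨p, hp, htot, hcons, hnone⟩ := h x y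
    refine ⟨_, List.mem_map.2 ⟨p, hmem p hp, rfl⟩, ?_⟩
    simp only [Rect.Contains, Finset.mem_filter, Finset.mem_univ, true_and]
    refine ⟨⟨htot, hcons⟩, ?_⟩
    obtain ⟨k, -, v, hv⟩ := htot y.toList
    rcases v with _ | b
    · exact absurd ⟨k, hv⟩ hnone
    · have hb : b = z := by
        cases b
        · have := (hcons y).2 ⟨k, hv⟩
          rw [← hxy]
          exact (Bool.eq_false_iff.2 this).symm
        · have := (hcons y).1 ⟨k, hv⟩
          rw [← hxy]
          exact (show g x y = true from this).symm
      exact ⟨k, hb ▸ hv⟩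

theorem Corresponds.mono {O : Oracle} {t T : ℕ → ℕ} (hT : ∀ k, t k ≤ T k) {n : ℕ} {y : Word n}
    {A : Set (Word n)} {p : List Bool} (h : Corresponds O t y A p) : Corresponds O T y A p := by
  obtain ⟨h₁, h₂⟩ := h
  refine ⟨fun u => ?_, h₂⟩
  obtain ⟨k, hk, hv⟩ := h₁ u
  exact ⟨k, hk.trans (hT _), hv⟩

/-- If the maximum instance complexity is bounded by a number, then it is a number `K`, and all
instances have corresponding programs of length at most `K`. -/
theorem exists_maxInstComplexity_eq {f : Family} {t : ℕ → ℕ} {n B : ℕ}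
    (h : ∀ x y, ∃ p : List Bool, p.length ≤ B ∧ Corresponds f.oracle t y (Y₁ (f n) x) p) :
    ∃ K ≤ B, maxInstComplexity f t n = (K : ℕ∞) ∧
      ∀ x y, ∃ p : List Bool, p.length ≤ K ∧ Corresponds f.oracle t y (Y₁ (f n) x) p := by
  have hle : maxInstComplexity f t n ≤ B := by
    refine iSup_le fun x => iSup_le fun y => ?_
    obtain ⟨p, hp, hc⟩ := h x y
    exact (iInf₂_le p hc).trans (by exact_mod_cast hp)
  obtain ⟨K, hK⟩ := ENat.ne_top_iff_exists.1 (ne_top_of_le_ne_top (ENat.natCast_ne_top B) hle)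
  refine ⟨K, by rw [← hK] at hle; exact_mod_cast hle, hK.symm, fun x y => ?_⟩
  have hxy : instComplexity f.oracle t y (Y₁ (f n) x) ≤ K := by
    rw [hK]
    exact le_iSup₂ (f := fun x y => instComplexity f.oracle t y (Y₁ (f n) x)) x y
  by_contra! hcon
  have : ((K + 1 : ℕ) : ℕ∞) ≤ instComplexity f.oracle t y (Y₁ (f n) x) :=
    le_iInf₂ fun p hp => by
      have hlt : K < p.length := by
        by_contra hlt
        exact hcon p (not_lt.1 hlt) hp
      exact_mod_cast hlt
  have := this.trans hxy
  norm_cast at this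
  omega

/-! ### Logarithmic estimates -/

/-- The size of a pair of minimum covers is a lower bound for the communication complexity. -/
theorem logb_le_commComplexity {n : ℕ} {g : Word n → Word n → Bool} {s₀ s₁ : List (Rect n)}
    (h₀ : IsMinCover g false s₀) (h₁ : IsMinCover g true s₁)
    (hpos : 0 < s₀.length + s₁.length) (hne : ∃ P : Protocol n, P.IsFor g) :
    Real.logb 2 ((s₀.length : ℝ) + (s₁.length : ℝ)) ≤ commComplexity g := by
  obtain ⟨P, hP⟩ := hne
  refine le_csInf ⟨_, P, hP, rfl⟩ ?_
  rintro r ⟨P, hP, rfl⟩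
  obtain ⟨c₀, hc₀, hl₀⟩ := P.exists_isCover_of_isFor hP false
  obtain ⟨c₁, hc₁, hl₁⟩ := P.exists_isCover_of_isFor hP true
  have hl₀' : (s₀.length : ℝ) ≤ 2 ^ P.sideCost g false := by
    exact_mod_cast (h₀.2 _ hc₀).trans hl₀
  have hl₁' : (s₁.length : ℝ) ≤ 2 ^ P.sideCost g true := by
    exact_mod_cast (h₁.2 _ hc₁).trans hl₁
  exact Real.logb_le_logb_of_le (by norm_num) (by exact_mod_cast hpos) (add_le_add hl₀' hl₁')

/-- A real infimum is a lower bound only for a set bounded below; here 0 serves, since each cost is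
the logarithm of a number at least 1. -/
theorem commComplexity_le_cost {n : ℕ} {g : Word n → Word n → Bool} {P : Protocol n}
    (hP : P.IsFor g) : commComplexity g ≤ P.cost g := by
  refine csInf_le ⟨0, ?_⟩ ⟨P, hP, rfl⟩
  rintro r ⟨Q, -, rfl⟩
  have : ∀ k : ℕ, (1 : ℝ) ≤ 2 ^ k := fun k => one_le_pow₀ (by norm_num)
  exact Real.logb_nonneg (by norm_num) (by linarith [this (Q.sideCost g false), this (Q.sideCost g true)])

theorem logb_le_clog {m : ℕ} (hm : 0 < m) : Real.logb 2 m ≤ Nat.clog 2 m := by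
  rw [Real.logb_le_iff_le_rpow (by norm_num) (by exact_mod_cast hm), Real.rpow_natCast]
  exact_mod_cast Nat.le_pow_clog (by norm_num) m

theorem clog_le_logb_add_one {m : ℕ} (hm : 0 < m) : (Nat.clog 2 m : ℝ) ≤ Real.logb 2 m + 1 := by
  rcases Nat.lt_or_ge 1 m with h | h
  · have h1 := Nat.pow_pred_clog_lt_self (b := 2) (by norm_num) h
    have h2 : ((Nat.clog 2 m).pred : ℝ) ≤ Real.logb 2 m := by
      rw [Real.le_logb_iff_rpow_le (by norm_num) (by exact_mod_cast hm), Real.rpow_natCast]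
      exact_mod_cast h1.le
    have h3 : (Nat.clog 2 m : ℝ) ≤ (Nat.clog 2 m).pred + 1 := by
      exact_mod_cast Nat.le_succ_of_pred_le le_rfl
    linarith
  · obtain rfl : m = 1 := by omega
    simp

theorem clog_le_of_le {n m m' : ℕ} (h : m ≤ 2 ^ n * 2 ^ n) (h' : m' ≤ 2 ^ n * 2 ^ n) :
    Nat.clog 2 (m + m') ≤ 2 * n + 1 := by
  apply Nat.clog_le_of_le_pow
  have : 2 ^ (2 * n + 1) = 2 ^ n * 2 ^ n + 2 ^ n * 2 ^ n := by ring
  omega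

end NDCC

/-! ### The theorem -/

theorem theorem2 (f : NDCC.Family) :
    ∃ t : ℕ → ℕ, Computable t ∧ ∃ c : ℝ,
      -- the equality up to an additive constant, for `t` and for all larger time bounds
      (∀ T : ℕ → ℕ, (∀ k, t k ≤ T k) → ∀ n : ℕ, ∃ K : ℕ,
        NDCC.maxInstComplexity f T n = (K : ℕ∞) ∧ |NDCC.commComplexity (f n) - (K : ℝ)| ≤ c) ∧
      -- the witnesses
      (∀ n : ℕ, ∃ s₀ s₁ : List (NDCC.Rect n),
        NDCC.IsFirstMinCover (f n) false s₀ ∧ NDCC.IsFirstMinCover (f n) true s₁ ∧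
        ∃ prog : Fin (s₀ ++ s₁).length → List Bool,
          (∀ i : Fin (s₀ ++ s₁).length,
            |((prog i).length : ℝ) - Real.logb 2 ((s₀.length : ℝ) + (s₁.length : ℝ))| ≤ c ∧
            NDCC.TotalWithin f.oracle t (prog i) ∧
            (∀ y : NDCC.Word n, ∃ k, NDCC.Outputs f.oracle (prog i) y.toList k
              (NDCC.rectAnswer ((s₀ ++ s₁).get i) (decide (s₀.length ≤ (i : ℕ))) y)) ∧
            (∀ x y : NDCC.Word n, NDCC.Rect.Contains ((s₀ ++ s₁).get i) x y →
              NDCC.Corresponds f.oracle t y (NDCC.Y₁ (f n) x) (prog i))) ∧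
          ∃ P : NDCC.Protocol n, P.IsFor (f n) ∧
            P.cost (f n) ≤ NDCC.commComplexity (f n) + c ∧
            ∀ (w : NDCC.Protocol.Guess) (x y : NDCC.Word n),
              P.output w x y ≠ none ↔
                ∃ i, w.1 = prog i ∧ NDCC.Rect.Contains ((s₀ ++ s₁).get i) x y) := by
  obtain ⟨M, t, ht, hM⟩ := NDCC.exists_coverMachine
  have main : ∀ n : ℕ, ∃ s₀ s₁ : List (NDCC.Rect n),
      NDCC.IsFirstMinCover (f n) false s₀ ∧ NDCC.IsFirstMinCover (f n) true s₁ ∧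
      (∀ x y, ∃ i, NDCC.Rect.Contains ((s₀ ++ s₁).get i) x y) ∧
      ∃ prog : Fin (s₀ ++ s₁).length → List Bool,
        (∀ i : Fin (s₀ ++ s₁).length,
          (prog i).length = M.code.length + Nat.clog 2 (s₀.length + s₁.length) ∧
          NDCC.TotalWithin f.oracle t (prog i) ∧
          (∀ y : NDCC.Word n, ∃ k, NDCC.Outputs f.oracle (prog i) y.toList k
            (NDCC.rectAnswer ((s₀ ++ s₁).get i) (decide (s₀.length ≤ (i : ℕ))) y)) ∧
          (∀ x y : NDCC.Word n, NDCC.Rect.Contains ((s₀ ++ s₁).get i) x y →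
            NDCC.Corresponds f.oracle t y (NDCC.Y₁ (f n) x) (prog i))) ∧
        ∃ P : NDCC.Protocol n, P.IsFor (f n) ∧
          P.cost (f n) ≤ Nat.clog 2 (s₀.length + s₁.length) + 3 ∧
          ∀ (w : NDCC.Protocol.Guess) (x y : NDCC.Word n),
            P.output w x y ≠ none ↔
              ∃ i, w.1 = prog i ∧ NDCC.Rect.Contains ((s₀ ++ s₁).get i) x y := by
    intro n
    obtain ⟨s₀, h₀, hl₀⟩ := NDCC.exists_codesFirst f n false
    obtain ⟨s₁, h₁, hl₁⟩ := NDCC.exists_codesFirst f n true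
    have hf₀ := h₀.isFirstMinCover
    have hf₁ := h₁.isFirstMinCover
    have hcolor : ∀ (i : Fin (s₀ ++ s₁).length) x y,
        NDCC.Rect.Contains ((s₀ ++ s₁).get i) x y → f n x y = decide (s₀.length ≤ (i : ℕ)) := by
      rintro ⟨i, hi⟩ x y hc
      rw [List.get_eq_getElem] at hc
      by_cases hlt : i < s₀.length
      · simp only [List.getElem_append_left hlt] at hc
        rw [hf₀.1.1.1 _ (List.getElem_mem hlt) x y hc]
        exact (decide_eq_false (not_le.2 hlt)).symm
      · have hi' : i - s₀.length < s₁.length := by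
          rw [List.length_append] at hi
          omega
        simp only [List.getElem_append_right (not_lt.1 hlt)] at hc
        rw [hf₁.1.1.1 _ (List.getElem_mem hi') x y hc]
        exact (decide_eq_true (not_lt.1 hlt)).symm
    have hcover : ∀ x y, ∃ i, NDCC.Rect.Contains ((s₀ ++ s₁).get i) x y := by
      intro x y
      have : ∃ R ∈ s₀ ++ s₁, R.Contains x y := by
        rcases hxy : f n x y
        · obtain ⟨R, hR, hc⟩ := hf₀.1.1.2 x y hxy
          exact ⟨R, List.mem_append_left _ hR, hc⟩
        · obtain ⟨R, hR, hc⟩ := hf₁.1.1.2 x y hxy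
          exact ⟨R, List.mem_append_right _ hR, hc⟩
      obtain ⟨R, hR, hc⟩ := this
      obtain ⟨i, rfl⟩ := List.get_of_mem hR
      exact ⟨i, hc⟩
    set L := Nat.clog 2 (s₀.length + s₁.length) with hL
    have hlen : (s₀ ++ s₁).length ≤ 2 ^ L := by
      rw [List.length_append]
      exact Nat.le_pow_clog (by norm_num) _
    have hLn : L ≤ 2 * n + 1 := NDCC.clog_le_of_le hl₀ hl₁
    -- All indices are padded to the common length L, so all programs have the same length, and L
    -- digits suffice to tell them apart.
    let prog : Fin (s₀ ++ s₁).length → List Bool := fun i =>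
      M.code ++ NDCC.digits (i : ℕ).testBit L
    have hval : ∀ i : Fin (s₀ ++ s₁).length, NDCC.binVal (NDCC.digits (i : ℕ).testBit L) = i :=
      fun i => NDCC.binVal_digits (i.2.trans_le hlen)
    have hinj : Function.Injective prog := by
      intro i j h
      have h' := List.append_cancel_left h
      apply Fin.ext
      rw [← hval i, h', hval j]
    have htotal : ∀ i, NDCC.TotalWithin f.oracle t (prog i) := by
      intro i u
      obtain ⟨k, hk, ho⟩ := hM f.oracle u (NDCC.digits (i : ℕ).testBit L)
      exact ⟨k, hk, _, ho⟩
    have hout : ∀ i (y : NDCC.Word n), ∃ k, NDCC.Outputs f.oracle (prog i) y.toList k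
        (NDCC.rectAnswer ((s₀ ++ s₁).get i) (decide (s₀.length ≤ (i : ℕ))) y) := by
      intro i y
      obtain ⟨k, -, ho⟩ := hM f.oracle y.toList (NDCC.digits (i : ℕ).testBit L)
      rw [List.Vector.toList_length, List.take_of_length_le (by rw [NDCC.length_digits]; omega),
        hval] at ho
      refine ⟨k, ?_⟩
      rw [← NDCC.outOf_coverAnswer f h₀ h₁ hl₀ hl₁ i y]
      exact ho
    have hans : ∀ i (y : NDCC.Word n) (k : ℕ) (v : Option Bool),
        NDCC.Outputs f.oracle (prog i) y.toList k v →
        v = if y ∈ ((s₀ ++ s₁).get i).2 then some (decide (s₀.length ≤ (i : ℕ))) else none := by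
      intro i y k v h
      obtain ⟨k', h'⟩ := hout i y
      exact h.det h'
    have hval' : ∀ i (x y : NDCC.Word n) (k : ℕ) (b : Bool), x ∈ ((s₀ ++ s₁).get i).1 →
        NDCC.Outputs f.oracle (prog i) y.toList k (some b) → f n x y = b := by
      intro i x y k b hx h
      have hb := hans i y k _ h
      split_ifs at hb with hy
      rw [hcolor i x y ⟨hx, hy⟩]
      exact (Option.some.inj hb).symm
    obtain ⟨P, hP, hPc, hPw⟩ := NDCC.Protocol.exists_protocol_of_rects (s₀ ++ s₁)
      (fun i => decide (s₀.length ≤ (i : ℕ))) hcolor hcover prog hinj hlen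
    refine ⟨s₀, s₁, hf₀, hf₁, hcover, prog, fun i => ⟨?_, htotal i, hout i, ?_⟩, P, hP, hPc, hPw⟩
    · simp [prog, NDCC.length_digits, hL]
    · rintro x y ⟨hx, hy⟩
      refine ⟨htotal i, fun u => ⟨?_, ?_⟩, ?_⟩
      · rintro ⟨k, hk⟩
        exact hval' i x u k true hx hk
      · rintro ⟨k, hk⟩ hmem
        have h1 := hval' i x u k false hx hk
        have h2 : f n x u = true := hmem
        rw [h1] at h2
        cases h2
      · rintro ⟨k, hk⟩
        have := hans i y k none hk
        rw [if_pos hy] at this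
        cases this
  have hpos : ∀ {n : ℕ} {s₀ s₁ : List (NDCC.Rect n)},
      (∀ x y, ∃ i, NDCC.Rect.Contains ((s₀ ++ s₁).get i) x y) → 0 < s₀.length + s₁.length := by
    intro n s₀ s₁ h
    obtain ⟨i, -⟩ := h (List.Vector.replicate n false) (List.Vector.replicate n false)
    rw [← List.length_append]
    exact i.pos
  have hcode : (0 : ℝ) ≤ M.code.length := Nat.cast_nonneg _
  -- With ℓ = log₂(m + m') and |M| the length of the machine's description: N ≤ L + 3 ≤ ℓ + 4 and ℓ
  -- ≤ K + 2 give N ≤ K + 6, while K ≤ |M| + L ≤ |M| + ℓ + 1 and ℓ ≤ N give K ≤ N + |M| + 1.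
  refine ⟨t, ht, M.code.length + 6, fun T hT n => ?_, fun n => ?_⟩
  · obtain ⟨s₀, s₁, h₀, h₁, hcover, prog, hprog, P, hP, hPc, -⟩ := main n
    have hp := hpos hcover
    obtain ⟨K, hKle, hK, hKp⟩ := NDCC.exists_maxInstComplexity_eq (f := f) (t := T) (n := n)
      (B := M.code.length + Nat.clog 2 (s₀.length + s₁.length)) (by
        intro x y
        obtain ⟨i, hi⟩ := hcover x y
        exact ⟨prog i, (hprog i).1.le, ((hprog i).2.2.2 x y hi).mono hT⟩)
    refine ⟨K, hK, ?_⟩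
    have hlow := NDCC.logb_le_commComplexity h₀.1 h₁.1 hp ⟨P, hP⟩
    have hup := (NDCC.commComplexity_le_cost hP).trans hPc
    have hclog := NDCC.clog_le_logb_add_one hp
    push_cast at hclog
    have hK1 : (K : ℝ) ≤ M.code.length + Nat.clog 2 (s₀.length + s₁.length) := by
      exact_mod_cast hKle
    -- The programs of length at most K yield a cover of at most 2^(K+1) rectangles for each of the
    -- two colours.
    have hK2 : Real.logb 2 ((s₀.length : ℝ) + (s₁.length : ℝ)) ≤ K + 2 := by
      obtain ⟨c₀, hc₀, hl₀⟩ := NDCC.exists_isCover_of_corresponds hKp false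
      obtain ⟨c₁, hc₁, hl₁⟩ := NDCC.exists_isCover_of_corresponds hKp true
      have hs : s₀.length + s₁.length ≤ 2 ^ (K + 2) := by
        have h2 : 2 ^ (K + 2) = 2 ^ (K + 1) + 2 ^ (K + 1) := by ring
        have := h₀.1.2 _ hc₀
        have := h₁.1.2 _ hc₁
        omega
      rw [Real.logb_le_iff_le_rpow (by norm_num) (by exact_mod_cast hp)]
      have e : ((K : ℝ) + 2) = ((K + 2 : ℕ) : ℝ) := by push_cast; rfl
      rw [e, Real.rpow_natCast]
      exact_mod_cast hs
    rw [abs_le]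
    constructor <;> linarith
  · obtain ⟨s₀, s₁, h₀, h₁, hcover, prog, hprog, P, hP, hPc, hPw⟩ := main n
    have hp := hpos hcover
    have hlow := NDCC.logb_le_commComplexity h₀.1 h₁.1 hp ⟨P, hP⟩
    have hclog := NDCC.clog_le_logb_add_one hp
    have hclog' := NDCC.logb_le_clog hp
    push_cast at hclog hclog'
    refine ⟨s₀, s₁, h₀, h₁, prog, fun i => ⟨?_, (hprog i).2⟩, P, hP, by linarith, hPw⟩
    rw [(hprog i).1, abs_le]
    push_cast
    constructor <;> linarith
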